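/- **Conventions.** Let $(P,\le_P)$ be a quasi-order with $P$ a set, and let $P^{<\omega}$ be the set of finite sequences over $P$ with the embeddability order: $s\preceq t$ iff $s$ is pointwise $\le_P$-below some subsequence of $t$ of the same length. A quasi-order is a *wqo* if every infinite sequence $(x_n)_{n\in\omega}$ in it has $m<n$ with $x_m\le x_n$. *$\zeta$-wqo, bqo.* For $\sigma\subseteq\omega$ finite and $X\subseteq\omega$, $\sigma\sqsubseteq X$ means that $\sigma$ is an initial segment of $X$. A *front* is an infinite $\sqsubseteq$-antichain $F\subseteq[\omega]^{<\omega}$ such that every infinite $X\subseteq\bigcup F$ has an initial segment in $F$, together with a function $\mathrm{rk}_F$ from the set $T_F$ of proper initial segments of elements of $F$ to the ordinals, with $\mathrm{rk}_F(\sigma)>\mathrm{rk}_F(\tau)$ whenever $\sigma\sqsubset\tau$ in $T_F$ ($\sqsubset$ denoting proper initial segments). Its rank is $<\zeta$ if $\mathrm{rk}_F(\emptyset)<\zeta$. For nonempty $\sigma,\tau\in[\omega]^{<\omega}$ put $\sigma\triangleleft\tau$ iff $\min\sigma<\min\tau$ and $\sigma\setminus\{\min\sigma\}$ is $\sqsubseteq$-comparable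 with $\tau$. A function $f\colon F\to P$ is a *bad array* if $f(\sigma)\not\le_P f(\tau)$ for all $\sigma,\tau\in F$ with $\sigma\triangleleft\tau$; its rank is that of $F$. $P$ is a *$\zeta$-wqo* if it is well-founded and there are no bad arrays $F\to P$ of rank $<\zeta$; $P$ is a *bqo* if it is a $\zeta$-wqo for every ordinal $\zeta$. *Iterated ideals.* Let $(Q,\le_Q)$ be a quasi-order with $Q$ a set, and let $V(Q)$ be the universe of sets with the elements of $Q$ as urelements. Define $\lesssim^*_Q$ on $V(Q)$ recursively: for $x,y\in Q$, $x\lesssim^*_Q y$ iff $x\le_Q y$; if $x\notin Q$, $y\in Q$, iff $x\lesssim^*_Q\{y\}$; if $x\in Q$, $y\notin Q$, iff $\{x\}\lesssim^*_Q y$; and for $x,y\notin Q$, iff $\forall x'\in x\,\exists y'\in y\;(x'\lesssim^*_Q y')$. The rank of a set $x\in V(Q)\setminus Q$ is the least $\alpha$ such that every $y\in x\setminus Q$ has rank $<\alpha$; let $\dot V_\alpha(Q)$ consist of the urelements and the sets of rank $<\alpha$ having an urelement in their transitive closure. By recursion on $\alpha$ put $$\dot I^*_\alpha(Q)=Q\cup\{x\in\dot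 V_\alpha(Q): \forall x'\in x\,\exists\beta<\alpha\,(x'\in\dot I^*_\beta(Q))\text{ and }x\text{ is upward-directed for }\lesssim^*_Q\},$$ $$\hat I^*_\alpha(Q)=Q\cup\bigcup_{\beta<\alpha}\dot{\mathcal I}^f(\hat I^*_\beta(Q)),$$ where $\dot{\mathcal I}^f(S)$ is the set of nonempty $\lesssim^*_Q$-upward-directed subsets of $S$ of the form $S\setminus\bigcup_{a\in A}\{y\in S: a\lesssim^*_Q y\}$ with $A\subseteq S$ finite. Both are ordered by $\lesssim^*_Q$. **Statement.** 1. Let $\zeta$ be an ordinal and let $(P,\le_P)$ be a $\zeta$-wqo. Then for every ordinal $\alpha<\zeta$, $\hat I^*_\alpha(P^{<\omega})$ is a wqo. 2. In particular, if $(P,\le_P)$ is a bqo, then for every ordinal $\alpha$ both $\hat I^*_\alpha(P^{<\omega})$ and $\dot I^*_\alpha(P^{<\omega})$ are wqos. -/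

import Mathlib

universe u

/-! ### Fronts, arrays, `α`-wqos and bqos -/

namespace BQO

/-- `s` is an initial segment of `t`, written `s ⊑ t` (for sets of natural numbers, identified with
their increasing enumerations). -/
def InitSeg (s t : Set ℕ) : Prop :=
  s ⊆ t ∧ ∀ x ∈ t, ∀ y ∈ s, x ≤ y → x ∈ s

/-- A front `F` together with a rank function on the tree `T_F` of proper initial segments of its
elements, which decreases strictly along proper extensions. The values of `rk` outside `T_F` play
no role. -/
structure Front where
  /-- the underlying set `F` of finite sets of natural numbers -/
  carrier : Set (Finset ℕ)
  /-- the rank function -/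
  rk : Finset ℕ → Ordinal.{u}
  infinite : carrier.Infinite
  antichain : ∀ σ ∈ carrier, ∀ τ ∈ carrier, InitSeg (σ : Set ℕ) (τ : Set ℕ) → σ = τ
  exists_initSeg : ∀ X : Set ℕ, X.Infinite → (∀ n ∈ X, ∃ σ ∈ carrier, n ∈ σ) →
    ∃ σ ∈ carrier, InitSeg (σ : Set ℕ) X
  rk_lt : ∀ σ τ : Finset ℕ,
    (∃ ρ ∈ carrier, InitSeg (σ : Set ℕ) (ρ : Set ℕ) ∧ σ ≠ ρ) →
    (∃ ρ ∈ carrier, InitSeg (τ : Set ℕ) (ρ : Set ℕ) ∧ τ ≠ ρ) →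
    InitSeg (σ : Set ℕ) (τ : Set ℕ) → σ ≠ τ → rk τ < rk σ

/-- The relation `σ ◁ τ` between nonempty finite sets of natural numbers. -/
def Tri (σ τ : Finset ℕ) : Prop :=
  ∃ (hσ : σ.Nonempty) (hτ : τ.Nonempty), σ.min' hσ < τ.min' hτ ∧
    (InitSeg (σ.erase (σ.min' hσ) : Set ℕ) (τ : Set ℕ) ∨
      InitSeg (τ : Set ℕ) (σ.erase (σ.min' hσ) : Set ℕ))

/-- The array `f : F → P` is bad. -/
def IsBadArray {P : Type u} [Preorder P] (F : Front.{u}) (f : F.carrier → P) : Prop :=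
  ∀ σ τ : F.carrier, Tri σ.1 τ.1 → ¬ f σ ≤ f τ

/-- `P` is an `α`-wqo: it is well-founded, and there is no bad array into `P` of rank `< α`. -/
def IsAlphaWqo (P : Type u) [Preorder P] (α : Ordinal.{u}) : Prop :=
  WellFoundedLT P ∧
    ∀ F : Front.{u}, F.rk ∅ < α → ∀ f : F.carrier → P, ¬ IsBadArray F f

/-- `P` is a better quasi-order: it is an `α`-wqo for every ordinal `α`. -/
def IsBqo (P : Type u) [Preorder P] : Prop :=
  ∀ α : Ordinal.{u}, IsAlphaWqo P α

end BQO

/-! ### The universe `V(Q)` of sets over a set `Q` of urelements -/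

/-- Codes of sets with urelements from `Q`: well-founded trees with leaves labelled by `Q`
(compare `PSet`). -/
inductive PreUrset (Q : Type u) : Type (u + 1)
  | ur (q : Q) : PreUrset Q
  | mk (ι : Type u) (f : ι → PreUrset Q) : PreUrset Q

namespace PreUrset

variable {Q : Type u}

/-- Extensional equality of codes. -/
def Equiv : PreUrset Q → PreUrset Q → Prop
  | ur p, ur q => p = q
  | mk _ f, mk _ g => (∀ i, ∃ j, Equiv (f i) (g j)) ∧ (∀ j, ∃ i, Equiv (f i) (g j))
  | ur _, mk _ _ => False
  | mk _ _, ur _ => False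

theorem Equiv.refl : ∀ x : PreUrset Q, Equiv x x
  | ur _ => rfl
  | mk _ f => ⟨fun i => ⟨i, Equiv.refl (f i)⟩, fun i => ⟨i, Equiv.refl (f i)⟩⟩

theorem Equiv.symm : ∀ {x y : PreUrset Q}, Equiv x y → Equiv y x
  | ur _, ur _, h => Eq.symm h
  | mk _ _, mk _ _, h =>
    ⟨fun j => (h.2 j).imp fun _ hi => Equiv.symm hi,
      fun i => (h.1 i).imp fun _ hj => Equiv.symm hj⟩
  | ur _, mk _ _, h => h.elim
  | mk _ _, ur _, h => h.elim

theorem Equiv.trans : ∀ {x y z : PreUrset Q}, Equiv x y → Equiv y z → Equiv x z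
  | ur _, ur _, ur _, h, h' => Eq.trans h h'
  | mk _ _, mk _ _, mk _ _, h, h' =>
    ⟨fun i => let ⟨j, hj⟩ := h.1 i; let ⟨k, hk⟩ := h'.1 j; ⟨k, hj.trans hk⟩,
      fun k => let ⟨j, hj⟩ := h'.2 k; let ⟨i, hi⟩ := h.2 j; ⟨i, hi.trans hj⟩⟩
  | ur _, mk _ _, _, h, _ => h.elim
  | mk _ _, ur _, _, h, _ => h.elim
  | ur _, ur _, mk _ _, _, h => h.elim
  | mk _ _, mk _ _, ur _, _, h => h.elim

instance setoid (Q : Type u) : Setoid (PreUrset Q) :=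
  ⟨Equiv, Equiv.refl, Equiv.symm, Equiv.trans⟩

/-- The code is an urelement. -/
def IsUr : PreUrset Q → Prop
  | ur _ => True
  | mk _ _ => False

/-- The code `x` is an element of the code `y`. -/
def Mem (x : PreUrset Q) : PreUrset Q → Prop
  | ur _ => False
  | mk _ g => ∃ j, Equiv x (g j)

open Classical in
/-- The rank of a code; the value at urelements is a dummy. -/
noncomputable def rank : PreUrset Q → Ordinal.{u}
  | ur _ => 0
  | mk _ f => ⨆ i, if (f i).IsUr then 0 else Order.succ (rank (f i))

/-- The order `ur p ≲ y`, with `p` an urelement. -/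
def UrLesssim (r : Q → Q → Prop) (p : Q) : PreUrset Q → Prop
  | ur q => r p q
  | mk _ g => ∃ j, UrLesssim r p (g j)

/-- The order `x ≲ y` on codes. -/
def Lesssim (r : Q → Q → Prop) : PreUrset Q → PreUrset Q → Prop
  | ur p, y => UrLesssim r p y
  | mk _ f, ur q => ∀ i, Lesssim r (f i) (ur q)
  | mk _ f, mk _ g => ∀ i, ∃ j, Lesssim r (f i) (g j)

theorem Equiv.isUr_iff : ∀ {x y : PreUrset Q}, Equiv x y → (x.IsUr ↔ y.IsUr)
  | ur _, ur _, _ => Iff.rfl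
  | mk _ _, mk _ _, _ => Iff.rfl
  | ur _, mk _ _, h => h.elim
  | mk _ _, ur _, h => h.elim

theorem Mem.congr : ∀ {x x' y y' : PreUrset Q}, Equiv x x' → Equiv y y' → (Mem x y ↔ Mem x' y')
  | _, _, ur _, ur _, _, _ => Iff.rfl
  | _, _, mk _ _, mk _ _, hx, hy =>
    ⟨fun ⟨i, hi⟩ => let ⟨j, hj⟩ := hy.1 i; ⟨j, hx.symm.trans (hi.trans hj)⟩,
      fun ⟨j, hj⟩ => let ⟨i, hi⟩ := hy.2 j; ⟨i, hx.trans (hj.trans hi.symm)⟩⟩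
  | _, _, ur _, mk _ _, _, h => h.elim
  | _, _, mk _ _, ur _, _, h => h.elim

theorem rank_le_iff {ι : Type u} {f : ι → PreUrset Q} {α : Ordinal.{u}} :
    rank (mk ι f) ≤ α ↔ ∀ i, ¬ (f i).IsUr → rank (f i) < α := by
  rw [rank, Ordinal.iSup_le_iff]
  refine forall_congr' fun i => ?_
  by_cases h : (f i).IsUr <;> simp [h]

theorem Equiv.rank_eq : ∀ {x y : PreUrset Q}, Equiv x y → rank x = rank y
  | ur _, ur _, _ => rfl
  | mk _ f, mk _ g, h => by
    refine le_antisymm (rank_le_iff.2 fun i hi => ?_) (rank_le_iff.2 fun j hj => ?_)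
    · obtain ⟨j, hj⟩ := h.1 i
      rw [Equiv.rank_eq hj]
      exact rank_le_iff.1 le_rfl j (fun h' => hi (hj.isUr_iff.2 h'))
    · obtain ⟨i, hi⟩ := h.2 j
      rw [← Equiv.rank_eq hi]
      exact rank_le_iff.1 le_rfl i (fun h' => hj (hi.isUr_iff.1 h'))
  | ur _, mk _ _, h => h.elim
  | mk _ _, ur _, h => h.elim

theorem UrLesssim.congr (r : Q → Q → Prop) (p : Q) :
    ∀ {y y' : PreUrset Q}, Equiv y y' → UrLesssim r p y → UrLesssim r p y'
  | ur _, ur _, hy, h => (show _ = _ from hy) ▸ h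
  | mk _ _, mk _ _, hy, ⟨i, hi⟩ =>
    let ⟨j, hj⟩ := hy.1 i; ⟨j, UrLesssim.congr r p hj hi⟩
  | ur _, mk _ _, h, _ => h.elim
  | mk _ _, ur _, h, _ => h.elim

theorem Lesssim.congr (r : Q → Q → Prop) : ∀ {x x' y y' : PreUrset Q},
    Equiv x x' → Equiv y y' → Lesssim r x y → Lesssim r x' y'
  | ur _, ur _, _, _, hx, hy, h => (show _ = _ from hx) ▸ UrLesssim.congr r _ hy h
  | mk _ _, mk _ _, ur _, ur _, hx, hy, h => fun j =>
    let ⟨i, hi⟩ := hx.2 j; Lesssim.congr r hi hy (h i)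
  | mk _ _, mk _ _, mk _ _, mk _ _, hx, hy, h => fun j =>
    let ⟨i, hi⟩ := hx.2 j
    let ⟨k, hk⟩ := h i
    let ⟨l, hl⟩ := hy.1 k
    ⟨l, Lesssim.congr r hi hl hk⟩
  | ur _, mk _ _, _, _, h, _, _ => h.elim
  | mk _ _, ur _, _, _, h, _, _ => h.elim
  | mk _ _, mk _ _, ur _, mk _ _, _, h, _ => h.elim
  | mk _ _, mk _ _, mk _ _, ur _, _, h, _ => h.elim

end PreUrset

/-- The universe `V(Q)`: sets with urelements from `Q`, that is, codes up to extensional equality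
(compare `ZFSet`). -/
def Urset (Q : Type u) : Type (u + 1) :=
  Quotient (PreUrset.setoid Q)

namespace Urset

variable {Q : Type u}

/-- The element `q` of `Q`, as an urelement. -/
def ur (q : Q) : Urset Q :=
  Quotient.mk _ (PreUrset.ur q)

/-- `x` is an urelement, that is, `x ∈ Q`. -/
def IsUr : Urset Q → Prop :=
  Quotient.lift PreUrset.IsUr fun _ _ h => propext (PreUrset.Equiv.isUr_iff h)

/-- Membership `x ∈ y`. -/
def Mem : Urset Q → Urset Q → Prop :=
  Quotient.lift₂ PreUrset.Mem fun _ _ _ _ h h' => propext (PreUrset.Mem.congr h h')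

/-- The elements of `x`. -/
def elems (x : Urset Q) : Set (Urset Q) :=
  {y | Mem y x}

/-- The rank of a set; on urelements, where the rank is undefined, the value is a dummy. -/
noncomputable def rank : Urset Q → Ordinal.{u} :=
  Quotient.lift PreUrset.rank fun _ _ h => PreUrset.Equiv.rank_eq h

/-- The relation `x ≲* y` on `V(Q)` induced by a relation `r` on `Q`. It is determined by the four
clauses `lesssim_ur_ur`, `lesssim_set_ur`, `lesssim_ur_set` and `lesssim_set_set` below. -/
def Lesssim (r : Q → Q → Prop) : Urset Q → Urset Q → Prop :=
  Quotient.lift₂ (PreUrset.Lesssim r) fun _ _ _ _ h h' => propext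
    ⟨PreUrset.Lesssim.congr r h h',
      PreUrset.Lesssim.congr r (PreUrset.Equiv.symm h) (PreUrset.Equiv.symm h')⟩

theorem ur_injective : Function.Injective (ur : Q → Urset Q) := fun _ _ h =>
  (Quotient.exact h : PreUrset.Equiv _ _)

theorem isUr_iff {x : Urset Q} : IsUr x ↔ ∃ q, x = ur q := by
  refine ⟨?_, ?_⟩
  · induction x using Quotient.inductionOn with | _ x => ?_
    cases x with
    | ur q => exact fun _ => ⟨q, rfl⟩
    | mk ι f => exact fun h => h.elim
  · rintro ⟨q, rfl⟩
    trivial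

/-- Every small class of elements of `V(Q)` is a set. -/
theorem exists_elems_eq (s : Set (Urset Q)) [Small.{u} s] :
    ∃ x : Urset Q, ¬ IsUr x ∧ elems x = s := by
  refine ⟨Quotient.mk _ (PreUrset.mk (Shrink.{u} s) fun i => ((equivShrink s).symm i).1.out),
    fun h => h, ?_⟩
  ext y
  induction y using Quotient.inductionOn with | _ y => ?_
  constructor
  · rintro ⟨i, hi⟩
    have : Quotient.mk _ y = ((equivShrink s).symm i).1 := by
      rw [← Quotient.out_eq ((equivShrink s).symm i).1]
      exact Quotient.sound hi
    rw [this]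
    exact ((equivShrink s).symm i).2
  · intro h
    refine ⟨equivShrink s ⟨_, h⟩, ?_⟩
    simp only [Equiv.symm_apply_apply]
    exact PreUrset.Equiv.symm (Quotient.mk_out (s := PreUrset.setoid Q) y)

theorem elems_eq_empty_of_isUr {x : Urset Q} (hx : IsUr x) : elems x = ∅ := by
  obtain ⟨q, rfl⟩ := isUr_iff.1 hx
  ext y
  induction y using Quotient.inductionOn with | _ y => ?_
  exact Iff.rfl

/-- Extensionality for sets. -/
theorem ext {x y : Urset Q} (hx : ¬ IsUr x) (hy : ¬ IsUr y) (h : elems x = elems y) : x = y := by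
  induction x using Quotient.inductionOn with | _ x => ?_
  induction y using Quotient.inductionOn with | _ y => ?_
  cases x with
  | ur q => exact (hx trivial).elim
  | mk ι f =>
    cases y with
    | ur q => exact (hy trivial).elim
    | mk κ g =>
      refine Quotient.sound ⟨fun i => ?_, fun j => ?_⟩
      · exact (Set.ext_iff.1 h (Quotient.mk _ (f i))).1 ⟨i, PreUrset.Equiv.refl _⟩
      · obtain ⟨i, hi⟩ := (Set.ext_iff.1 h (Quotient.mk _ (g j))).2 ⟨j, PreUrset.Equiv.refl _⟩
        exact ⟨i, PreUrset.Equiv.symm hi⟩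

/-- Foundation: induction along membership. -/
theorem mem_induction {C : Urset Q → Prop} (h : ∀ x, (∀ y ∈ elems x, C y) → C x) (x : Urset Q) :
    C x := by
  induction x using Quotient.inductionOn with | _ x => ?_
  induction x with
  | ur q =>
    refine h _ fun y hy => ?_
    have := elems_eq_empty_of_isUr (x := ur q) trivial
    exact absurd (this ▸ hy : y ∈ (∅ : Set (Urset Q))) (Set.notMem_empty y)
  | mk ι f ih =>
    refine h _ fun y hy => ?_
    induction y using Quotient.inductionOn with | _ y => ?_
    obtain ⟨i, hi⟩ := hy
    have : Quotient.mk (PreUrset.setoid Q) y = Quotient.mk _ (f i) := Quotient.sound hi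
    rw [this]
    exact ih i

theorem rank_le_iff {x : Urset Q} (hx : ¬ IsUr x) {α : Ordinal.{u}} :
    rank x ≤ α ↔ ∀ y ∈ elems x, ¬ IsUr y → rank y < α := by
  induction x using Quotient.inductionOn with | _ x => ?_
  cases x with
  | ur q => exact (hx trivial).elim
  | mk ι f =>
    refine PreUrset.rank_le_iff.trans ⟨fun h y hy hy' => ?_, fun h i hi => ?_⟩
    · induction y using Quotient.inductionOn with | _ y => ?_
      obtain ⟨i, hi⟩ := hy
      have e : Quotient.mk (PreUrset.setoid Q) y = Quotient.mk _ (f i) := Quotient.sound hi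
      rw [e] at hy' ⊢
      exact h i hy'
    · exact h (Quotient.mk _ (f i)) ⟨i, PreUrset.Equiv.refl _⟩ hi

theorem lesssim_ur_ur (r : Q → Q → Prop) (p q : Q) : Lesssim r (ur p) (ur q) ↔ r p q :=
  Iff.rfl

theorem lesssim_set_set (r : Q → Q → Prop) {x y : Urset Q} (hx : ¬ IsUr x) (hy : ¬ IsUr y) :
    Lesssim r x y ↔ ∀ x' ∈ elems x, ∃ y' ∈ elems y, Lesssim r x' y' := by
  induction x using Quotient.inductionOn with | _ x => ?_
  induction y using Quotient.inductionOn with | _ y => ?_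
  cases x with
  | ur q => exact (hx trivial).elim
  | mk ι f =>
    cases y with
    | ur q => exact (hy trivial).elim
    | mk κ g =>
      constructor
      · intro h x' hx'
        induction x' using Quotient.inductionOn with | _ x' => ?_
        obtain ⟨i, hi⟩ := hx'
        obtain ⟨j, hj⟩ := h i
        exact ⟨Quotient.mk _ (g j), ⟨j, PreUrset.Equiv.refl _⟩,
          PreUrset.Lesssim.congr r (PreUrset.Equiv.symm hi) (PreUrset.Equiv.refl _) hj⟩
      · intro h i
        obtain ⟨y', hy', hl⟩ := h (Quotient.mk _ (f i)) ⟨i, PreUrset.Equiv.refl _⟩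
        induction y' using Quotient.inductionOn with | _ y' => ?_
        obtain ⟨j, hj⟩ := hy'
        exact ⟨j, PreUrset.Lesssim.congr r (PreUrset.Equiv.refl _) hj hl⟩

/-- If `y` is an urelement and `x` is not, then `x ≲* y` iff `x ≲* {y}`. -/
theorem lesssim_set_ur (r : Q → Q → Prop) {x y s : Urset Q} (hx : ¬ IsUr x) (hy : IsUr y)
    (hs : ¬ IsUr s) (hsy : elems s = {y}) : Lesssim r x y ↔ Lesssim r x s := by
  rw [lesssim_set_set r hx hs]
  simp only [hsy, Set.mem_singleton_iff, exists_eq_left]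
  obtain ⟨q, rfl⟩ := isUr_iff.1 hy
  induction x using Quotient.inductionOn with | _ x => ?_
  cases x with
  | ur q => exact (hx trivial).elim
  | mk ι f =>
    constructor
    · intro h x' hx'
      induction x' using Quotient.inductionOn with | _ x' => ?_
      obtain ⟨i, hi⟩ := hx'
      exact PreUrset.Lesssim.congr r (PreUrset.Equiv.symm hi) (PreUrset.Equiv.refl _) (h i)
    · exact fun h i => h (Quotient.mk _ (f i)) ⟨i, PreUrset.Equiv.refl _⟩

/-- If `x` is an urelement and `y` is not, then `x ≲* y` iff `{x} ≲* y`. -/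
theorem lesssim_ur_set (r : Q → Q → Prop) {x y s : Urset Q} (hx : IsUr x) (hy : ¬ IsUr y)
    (hs : ¬ IsUr s) (hsx : elems s = {x}) : Lesssim r x y ↔ Lesssim r s y := by
  rw [lesssim_set_set r hs hy]
  simp only [hsx, Set.mem_singleton_iff, forall_eq]
  obtain ⟨q, rfl⟩ := isUr_iff.1 hx
  induction y using Quotient.inductionOn with | _ y => ?_
  cases y with
  | ur q => exact (hy trivial).elim
  | mk ι g =>
    constructor
    · rintro ⟨j, hj⟩
      exact ⟨Quotient.mk _ (g j), ⟨j, PreUrset.Equiv.refl _⟩, hj⟩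
    · rintro ⟨y', hy', hl⟩
      induction y' using Quotient.inductionOn with | _ y' => ?_
      obtain ⟨j, hj⟩ := hy'
      exact ⟨j, PreUrset.UrLesssim.congr r _ hj hl⟩

/-! ### Iterated ideals -/

/-- `V̇(Q)`: the urelements, and the sets with an urelement in their transitive closure. -/
def dotV (Q : Type u) : Set (Urset Q) :=
  {x | IsUr x ∨ ∃ y, IsUr y ∧ Relation.TransGen Mem y x}

/-- `V̇_α(Q)`: the urelements, and the sets in `V̇(Q)` of rank `< α`. -/
def dotVLevel (Q : Type u) (α : Ordinal.{u}) : Set (Urset Q) :=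
  {x | x ∈ dotV Q ∧ (IsUr x ∨ rank x < α)}

/-- The iterated ideals `İ*_α(Q)`: the elements of `V̇_α(Q)` which are hereditarily
upward-directed with respect to `≲*`. -/
def iteratedIdeals (r : Q → Q → Prop) (α : Ordinal.{u}) : Set (Urset Q) :=
  {x | IsUr x} ∪
    {x | x ∈ dotVLevel Q α ∧
      (∀ x' ∈ elems x, ∃ β : Set.Iio α, x' ∈ iteratedIdeals r β.1) ∧
      DirectedOn (Lesssim r) (elems x)}
termination_by α
decreasing_by exact β.2

/-- The nonempty upward-directed sets of the form `S ∖ ⋃_{a ∈ A} a↑`, for finite `A ⊆ S`. -/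
def finiteTypeIdeals (r : Q → Q → Prop) (S : Set (Urset Q)) : Set (Urset Q) :=
  {x | ¬ IsUr x ∧ (elems x).Nonempty ∧
    (∃ A : Set (Urset Q), A.Finite ∧ A ⊆ S ∧ elems x = S \ ⋃ a ∈ A, {y | Lesssim r a y}) ∧
    DirectedOn (Lesssim r) (elems x)}

/-- The set approximation `Î*_α(Q)` of the iterated ideals:
`Î*_α(Q) = Q ∪ ⋃_{β < α} İ^f(Î*_β(Q), ≲*)`. -/
def approxIdeals (r : Q → Q → Prop) (α : Ordinal.{u}) : Set (Urset Q) :=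
  {x | IsUr x} ∪ ⋃ β : Set.Iio α, finiteTypeIdeals r (approxIdeals r β.1)
termination_by α
decreasing_by exact β.2

/-- `Î*_α(Q)` is a set, so that in its definition nothing is lost by letting the ideals `x` range
over elements of `V(Q)`. -/
theorem small_approxIdeals (r : Q → Q → Prop) (α : Ordinal.{u}) :
    Small.{u} (approxIdeals r α) := by
  induction α using WellFoundedLT.induction with | _ α ih => ?_
  rw [approxIdeals]
  have h₁ : Small.{u} ({x | IsUr x} : Set (Urset Q)) := by
    have : ({x | IsUr x} : Set (Urset Q)) = Set.range ur := by
      ext x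
      simp [isUr_iff, eq_comm]
    rw [this]
    infer_instance
  have h₂ : ∀ β : Set.Iio α, Small.{u} (finiteTypeIdeals r (approxIdeals r β.1)) := by
    intro β
    have := ih β.1 β.2
    refine small_of_injective (β := Set (approxIdeals r β.1))
      (f := fun x => {y | y.1 ∈ elems x.1}) ?_
    rintro ⟨x, hx, hx', ⟨A, hA', hA'', hA⟩, hx''⟩ ⟨y, hy, hy', ⟨B, hB', hB'', hB⟩, hy''⟩ h
    refine Subtype.ext (ext hx hy ?_)
    ext z
    constructor <;> intro hz
    · exact (Set.ext_iff.1 h ⟨z, (hA ▸ hz).1⟩).1 hz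
    · exact (Set.ext_iff.1 h ⟨z, (hB ▸ hz).1⟩).2 hz
  infer_instance

end Urset

/-- The embeddability relation on the set `P^{<ω}` of finite sequences over `P`: `s` is pointwise
below a subsequence of `t`. -/
def SeqEmbed (P : Type u) [Preorder P] : List P → List P → Prop :=
  List.SublistForall₂ (· ≤ ·)

/-! ### Initial segments of sets of natural numbers -/

namespace BQO

/-! Members of both hierarchies are hereditarily nonempty directed sets. Each such set over `P^{<ω}`
is equivalent under `≲*` to a finite word of codes whose ranks are bounded by its own
(`HereditarilyDirected.exists_word`). By Higman's lemma it therefore suffices that the codes of rank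
below `α` are well-quasi-ordered.

Codes arise by iterating the description of ideals of words over a wqo: such an ideal is a finite
product of factors, each being either "at most one letter from an ideal" or "all words over a
down-closed set". The two kinds become the codes `letter` and `star`, the latter carrying a mark, so
a code is a set over `P` with one extra incomparable point. From a bad sequence of such sets of rank
below `α`, repeated choice of witnesses produces a bad array of urelements of rank at most `α`
(`PreUrset.partiallyWellOrderedOn_rank_lt`), and a Nash-Williams partition argument disposes of the
extra point (`not_isBadArray_sum`). This contradicts the hypothesis on `P`, since `α < ζ`.

To represent a directed set `x`, represent its elements by words over a set of codes of smaller rank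
and consider all words lying below some element of `x`. Being cofinal for `x` passes to one of
finitely many pieces because `x` is directed, so a single product of ideals is already cofinal
(`exists_lang_subset`, `exists_isIdeal_lang_subset`). Each factor folds into at most one code
(`exists_represents_lang`). The delicate factor is an ideal of single codes in which the `star`
codes are cofinal; a `star` code over it contains more words, but repeating a `star` code leads to
nothing new (`WordLe.pump`).

Equivalence is split into `SetLe` and `WordLe`, which `SetLe.lesssim` composes with embeddings of
words. -/

theorem InitSeg.refl (s : Set ℕ) : InitSeg s s := ⟨subset_rfl, fun _ hx _ _ _ => hx⟩

theorem InitSeg.trans {s t v : Set ℕ} (h : InitSeg s t) (h' : InitSeg t v) : InitSeg s v :=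
  ⟨h.1.trans h'.1, fun x hx y hy hxy => h.2 x (h'.2 x hx y (h.1 hy) hxy) y hy hxy⟩

theorem InitSeg.comparable {s t v : Set ℕ} (h : InitSeg s v) (h' : InitSeg t v) :
    InitSeg s t ∨ InitSeg t s := by
  by_cases hst : s ⊆ t
  · exact .inl ⟨hst, fun x hx y hy hxy => h.2 x (h'.1 hx) y hy hxy⟩
  · obtain ⟨a, ha, hat⟩ := Set.not_subset.1 hst
    refine .inr ⟨fun y hy => ?_, fun x hx y hy hxy => h'.2 x (h.1 hx) y hy hxy⟩
    refine h.2 y (h'.1 hy) a ha (le_of_lt (lt_of_not_ge fun hle => hat ?_))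
    exact h'.2 a (h.1 ha) y hy hle

/-- A set of natural numbers without its minimum. -/
def tail (X : Set ℕ) : Set ℕ := X \ {sInf X}

theorem infinite_tail {X : Set ℕ} (hX : X.Infinite) : (tail X).Infinite :=
  hX.sdiff (Set.finite_singleton _)

theorem sInf_lt_of_mem_tail {X : Set ℕ} {n : ℕ} (hn : n ∈ tail X) : sInf X < n :=
  lt_of_le_of_ne (Nat.sInf_le hn.1) (Ne.symm hn.2)

theorem sInf_lt_sInf_tail {X : Set ℕ} (hX : X.Infinite) : sInf X < sInf (tail X) :=
  sInf_lt_of_mem_tail (Nat.sInf_mem (infinite_tail hX).nonempty)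

theorem InitSeg.sInf_eq {s X : Set ℕ} (h : InitSeg s X) (hs : s.Nonempty) : sInf s = sInf X := by
  have hX : X.Nonempty := hs.mono h.1
  refine le_antisymm (Nat.sInf_le ?_) (Nat.sInf_le (h.1 (Nat.sInf_mem hs)))
  exact h.2 _ (Nat.sInf_mem hX) _ (Nat.sInf_mem hs) (Nat.sInf_le (h.1 (Nat.sInf_mem hs)))

theorem InitSeg.tail {s X : Set ℕ} (h : InitSeg s X) (hs : s.Nonempty) :
    InitSeg (tail s) (tail X) := by
  unfold BQO.tail
  rw [h.sInf_eq hs]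
  exact ⟨Set.sdiff_subset_sdiff_left h.1, fun x hx y hy hxy => ⟨h.2 x hx.1 y hy.1 hxy, hx.2⟩⟩

/-- The union of `s` and the set of all upper bounds of `s` outside `s`. -/
def extend (s : Set ℕ) : Set ℕ := s ∪ {m | ∀ n ∈ s, n < m}

theorem initSeg_extend (s : Set ℕ) : InitSeg s (extend s) := by
  refine ⟨Set.subset_union_left, ?_⟩
  rintro x (hx | hx) y hy hxy
  · exact hx
  · exact absurd (hx y hy) (not_lt.2 hxy)

theorem infinite_extend (s : Finset ℕ) : (extend (s : Set ℕ)).Infinite := by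
  refine Set.Infinite.mono (Set.subset_union_right (s := (s : Set ℕ))) ?_
  refine Set.infinite_of_forall_exists_gt fun a => ⟨max a (s.sup id) + 1, fun n hn => ?_, ?_⟩
  · have := Finset.le_sup (f := id) hn
    simp only [id] at this
    omega
  · omega

theorem sInf_coe (s : Finset ℕ) (hs : s.Nonempty) : sInf (s : Set ℕ) = s.min' hs := by
  refine le_antisymm (Nat.sInf_le (s.min'_mem hs)) ?_
  exact s.min'_le _ (Nat.sInf_mem (s := (s : Set ℕ)) hs)

theorem tail_coe (s : Finset ℕ) (hs : s.Nonempty) :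
    tail (s : Set ℕ) = (s.erase (s.min' hs) : Finset ℕ) := by
  rw [tail, sInf_coe s hs, Finset.coe_erase]

theorem InitSeg.eq_of_card_le {s t : Finset ℕ} (h : InitSeg (s : Set ℕ) t) (hc : t.card ≤ s.card) :
    s = t :=
  Finset.eq_of_subset_of_card_le (Finset.coe_subset.1 h.1) hc

theorem InitSeg.card_lt {s t : Finset ℕ} (h : InitSeg (s : Set ℕ) t) (hne : s ≠ t) :
    s.card < t.card :=
  lt_of_not_ge fun hc => hne (h.eq_of_card_le hc)

/-- Related elements of a front can be read off from a common infinite set. -/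
theorem Tri.exists_infinite {σ τ : Finset ℕ} (h : Tri σ τ) :
    ∃ X : Set ℕ, X.Infinite ∧ InitSeg (σ : Set ℕ) X ∧ InitSeg (τ : Set ℕ) (tail X) := by
  obtain ⟨hσ, hτ, hlt, hc⟩ := h
  have hmin : ∀ n ∈ τ, σ.min' hσ < n := fun n hn => hlt.trans_le (τ.min'_le n hn)
  have hσ' : ∀ n ∈ σ, σ.min' hσ ≤ n := fun n hn => σ.min'_le n hn
  rcases hc with hc | hc
  -- Here `σ` without its minimum is an initial segment of `τ`, so `{min σ} ∪ τ` records both sets;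
  -- in the other case `σ` already does.
  · let ρ : Finset ℕ := insert (σ.min' hσ) τ
    have hρ : ρ.Nonempty := Finset.insert_nonempty _ _
    have hρm : ρ.min' hρ = σ.min' hσ := by
      refine le_antisymm (ρ.min'_le _ (Finset.mem_insert_self _ _)) ?_
      refine Finset.le_min' _ _ _ fun n hn => ?_
      rcases Finset.mem_insert.1 hn with rfl | hn
      · exact le_rfl
      · exact (hmin n hn).le
    have hρt : tail (ρ : Set ℕ) = τ := by
      rw [tail_coe _ hρ, hρm, Finset.erase_insert]
      exact fun hm => lt_irrefl _ (hmin _ hm)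
    refine ⟨extend ρ, infinite_extend ρ, InitSeg.trans ?_ (initSeg_extend ρ), ?_⟩
    · refine ⟨fun n hn => ?_, fun x hx y hy hxy => ?_⟩
      · by_cases hnm : n = σ.min' hσ
        · exact hnm ▸ Finset.mem_coe.2 (Finset.mem_insert_self _ _)
        · exact Finset.mem_coe.2 (Finset.mem_insert_of_mem
            (hc.1 (Finset.mem_coe.2 (Finset.mem_erase.2 ⟨hnm, hn⟩))))
      · rcases Finset.mem_insert.1 (Finset.mem_coe.1 hx) with rfl | hx
        · exact σ.min'_mem hσ
        · have hym : y ≠ σ.min' hσ := fun he => absurd (hmin x hx) (not_lt.2 (he ▸ hxy))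
          exact Finset.mem_of_mem_erase
            (hc.2 x hx y (Finset.mem_coe.2 (Finset.mem_erase.2 ⟨hym, hy⟩)) hxy)
    · have := (initSeg_extend (ρ : Set ℕ)).tail hρ
      rwa [hρt] at this
  · refine ⟨extend σ, infinite_extend σ, initSeg_extend _, hc.trans ?_⟩
    rw [← tail_coe]
    exact (initSeg_extend (σ : Set ℕ)).tail hσ

end BQO

/-! ### Reflexivity and transitivity of `≲*` -/

namespace PreUrset

variable {Q : Type u} {r : Q → Q → Prop}

theorem Lesssim.refl [Std.Refl r] : ∀ x : PreUrset Q, Lesssim r x x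
  | ur p => Std.Refl.refl (r := r) p
  | mk _ f => fun i => ⟨i, Lesssim.refl (f i)⟩

theorem UrLesssim.trans_left [IsTrans Q r] {p q : Q} (h : r p q) :
    ∀ {z : PreUrset Q}, UrLesssim r q z → UrLesssim r p z
  | ur _, h' => _root_.trans h h'
  | mk _ _, ⟨j, hj⟩ => ⟨j, UrLesssim.trans_left h hj⟩

theorem UrLesssim.trans [IsTrans Q r] {p : Q} : ∀ {y z : PreUrset Q},
    UrLesssim r p y → Lesssim r y z → UrLesssim r p z
  | ur _, _, h, h' => UrLesssim.trans_left h h'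
  | mk _ _, ur _, ⟨j, hj⟩, h' => UrLesssim.trans hj (h' j)
  | mk _ _, mk _ _, ⟨j, hj⟩, h' =>
    let ⟨k, hk⟩ := h' j
    ⟨k, UrLesssim.trans hj hk⟩

theorem Lesssim.trans [IsTrans Q r] : ∀ {x y z : PreUrset Q},
    Lesssim r x y → Lesssim r y z → Lesssim r x z
  | ur _, _, _, h, h' => UrLesssim.trans h h'
  | mk _ _, ur _, ur _, h, h' => fun i => Lesssim.trans (h i) h'
  | mk _ _, ur _, mk _ _, h, ⟨k, hk⟩ => fun i => ⟨k, Lesssim.trans (h i) hk⟩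
  | mk _ _, mk _ _, ur _, h, h' => fun i =>
    let ⟨j, hj⟩ := h i
    Lesssim.trans hj (h' j)
  | mk _ _, mk _ _, mk _ _, h, h' => fun i =>
    let ⟨j, hj⟩ := h i
    let ⟨k, hk⟩ := h' j
    ⟨k, Lesssim.trans hj hk⟩

/-! ### Bad sequences of sets and bad arrays of urelements -/

/-- `a` is one of the listed elements of the code. -/
def Child (a : PreUrset Q) : PreUrset Q → Prop
  | ur _ => False
  | mk _ f => ∃ i, f i = a

theorem Child.rank_lt : ∀ {a b : PreUrset Q}, Child a b → ¬ a.IsUr → rank a < rank b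
  | _, mk _ _, ⟨i, hi⟩, ha => hi ▸ rank_le_iff.1 le_rfl i (hi ▸ ha)

/-- `c` is an element of `a` witnessing `¬ a ≲ b`. -/
def IsWitness (r : Q → Q → Prop) (a b c : PreUrset Q) : Prop :=
  Child c a ∧ (b.IsUr → ¬ Lesssim r c b) ∧ ∀ b', Child b' b → ¬ Lesssim r c b'

theorem exists_isWitness : ∀ {a b : PreUrset Q}, ¬ Lesssim r a b → ¬ a.IsUr →
    ∃ c, IsWitness r a b c
  | ur _, _, _, h => absurd trivial h
  | mk _ f, ur _, h, _ => by
    obtain ⟨i, hi⟩ := not_forall.1 h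
    exact ⟨f i, ⟨i, rfl⟩, fun _ => hi, fun _ h => h.elim⟩
  | mk _ f, mk _ g, h, _ => by
    obtain ⟨i, hi⟩ := not_forall.1 h
    refine ⟨f i, ⟨i, rfl⟩, fun h => h.elim, ?_⟩
    rintro _ ⟨j, rfl⟩ hj
    exact hi ⟨j, hj⟩

open Classical in
/-- A witness of `¬ a ≲ b` in `a`; urelements are kept. -/
noncomputable def next (r : Q → Q → Prop) (a b : PreUrset Q) : PreUrset Q :=
  if h : ∃ c, IsWitness r a b c then h.choose else a

theorem next_isWitness {a b : PreUrset Q} (h : ¬ Lesssim r a b) (ha : ¬ a.IsUr) :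
    IsWitness r a b (next r a b) := by
  rw [next, dif_pos (exists_isWitness h ha)]
  exact (exists_isWitness h ha).choose_spec

theorem next_of_isUr : ∀ {a b : PreUrset Q}, a.IsUr → next r a b = a
  | ur _, _, _ => dif_neg fun ⟨_, h⟩ => h.1
  | mk _ _, _, h => h.elim

theorem not_lesssim_of_child : ∀ {a b b' : PreUrset Q}, a.IsUr → ¬ Lesssim r a b → Child b' b →
    ¬ Lesssim r a b'
  | ur _, mk _ _, _, _, h, ⟨j, hj⟩ => fun h' => h ⟨j, hj ▸ h'⟩
  | mk _ _, _, _, h, _, _ => h.elim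

/-- Badness survives the passage to witnesses: a witness of `¬ a ≲ b` lies below no element of `b`,
nor below `b` if this is an urelement, and `next r b c` is one of these. If `a` is an urelement,
lying below an element of `b` would put it below `b`. -/
theorem not_lesssim_next {a b c : PreUrset Q} (hab : ¬ Lesssim r a b) (hbc : ¬ Lesssim r b c) :
    ¬ Lesssim r (next r a b) (next r b c) := by
  by_cases ha : a.IsUr
  · rw [next_of_isUr ha]
    by_cases hb : b.IsUr
    · rwa [next_of_isUr hb]
    · exact not_lesssim_of_child ha hab (next_isWitness hbc hb).1
  · have h := next_isWitness hab ha
    by_cases hb : b.IsUr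
    · rw [next_of_isUr hb]
      exact h.2.1 hb
    · exact h.2.2 _ (next_isWitness hbc hb).1

open BQO (InitSeg Tri tail)

/-- The iterated witnesses along a set `X` of natural numbers, starting with `x (min X)`. -/
noncomputable def descend (r : Q → Q → Prop) (x : ℕ → PreUrset Q) : ℕ → Set ℕ → PreUrset Q
  | 0, X => x (sInf X)
  | k + 1, X => next r (descend r x k X) (descend r x k (tail X))

variable {x : ℕ → PreUrset Q}

/-- Each stage looks one point further, so stage `k` reads only the first `k + 1` elements of `X`.
-/
theorem descend_congr {k : ℕ} : ∀ {s : Finset ℕ} {X : Set ℕ}, InitSeg (s : Set ℕ) X → k < s.card →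
    descend r x k s = descend r x k X := by
  induction k with
  | zero =>
    intro s X h hk
    rw [descend, descend, h.sInf_eq (Finset.card_pos.1 hk)]
  | succ k ih =>
    intro s X h hk
    have hs : s.Nonempty := Finset.card_pos.1 (by omega)
    have ht := h.tail hs
    rw [descend, descend, ih h (by omega)]
    rw [BQO.tail_coe _ hs] at ht ⊢
    rw [ih ht]
    rw [Finset.card_erase_of_mem (s.min'_mem hs)]
    omega

theorem descend_of_isUr {k : ℕ} {X : Set ℕ} (h : (descend r x k X).IsUr) :
    ∀ {l : ℕ}, k ≤ l → descend r x l X = descend r x k X := by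
  intro l hl
  induction l, hl using Nat.le_induction with
  | base => rfl
  | succ l _ ih => rw [descend, next_of_isUr (ih ▸ h), ih]

section

variable (hbad : ∀ m n, m < n → ¬ Lesssim r (x m) (x n))
include hbad

theorem descend_bad (k : ℕ) : ∀ {X : Set ℕ}, X.Infinite →
    ¬ Lesssim r (descend r x k X) (descend r x k (tail X)) := by
  induction k with
  | zero => exact fun hX => hbad _ _ (BQO.sInf_lt_sInf_tail hX)
  | succ k ih => exact fun hX => not_lesssim_next (ih hX) (ih (BQO.infinite_tail hX))

theorem rank_descend_succ {k : ℕ} {X : Set ℕ} (hX : X.Infinite)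
    (h : ¬ (descend r x (k + 1) X).IsUr) :
    ¬ (descend r x k X).IsUr ∧ rank (descend r x (k + 1) X) < rank (descend r x k X) := by
  have h' : ¬ (descend r x k X).IsUr := fun h' => h (by rwa [descend_of_isUr h' (Nat.le_succ k)])
  exact ⟨h', (next_isWitness (descend_bad hbad k hX) h').1.rank_lt h⟩

theorem rank_descend_lt {k l : ℕ} {X : Set ℕ} (hX : X.Infinite) (hkl : k < l)
    (h : ¬ (descend r x l X).IsUr) : rank (descend r x l X) < rank (descend r x k X) := by
  induction l, hkl using Nat.le_induction with
  | base => exact (rank_descend_succ hbad hX h).2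
  | succ l _ ih =>
    have := rank_descend_succ hbad hX h
    exact this.2.trans (ih this.1)

/-- Ranks drop strictly as long as no urelement is reached. -/
theorem exists_isUr_descend {X : Set ℕ} (hX : X.Infinite) : ∃ k, (descend r x k X).IsUr := by
  by_contra! h
  exact (RelEmbedding.natGT (r := (· < ·)) (fun k => rank (descend r x k X))
    fun k => (rank_descend_succ hbad hX (h (k + 1))).2).not_wellFounded wellFounded_lt

end

/-- The finite sets along which the iterated witnesses first reach an urelement. -/
def frontCarrier (r : Q → Q → Prop) (x : ℕ → PreUrset Q) : Set (Finset ℕ) :=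
  {σ | ∃ k, σ.card = k + 1 ∧ (descend r x k σ).IsUr ∧ ∀ j < k, ¬ (descend r x j σ).IsUr}

theorem frontCarrier_antichain {σ τ : Finset ℕ} (hσ : σ ∈ frontCarrier r x)
    (hτ : τ ∈ frontCarrier r x) (h : InitSeg (σ : Set ℕ) τ) : σ = τ := by
  obtain ⟨k, hk, hku, -⟩ := hσ
  obtain ⟨l, hl, -, hlu⟩ := hτ
  refine h.eq_of_card_le (le_of_not_gt fun hc => hlu k (by omega) ?_)
  rwa [← descend_congr h (by omega)]

theorem exists_initSeg_card {X : Set ℕ} (hX : X.Infinite) (n : ℕ) :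
    ∃ σ : Finset ℕ, σ.card = n ∧ InitSeg (σ : Set ℕ) X := by
  refine ⟨(Finset.range n).image (Nat.nth (· ∈ X)), ?_, ?_, ?_⟩
  · exact (Finset.card_image_of_injective _ (Nat.nth_injective hX)).trans (Finset.card_range n)
  · intro a ha
    obtain ⟨i, -, rfl⟩ := Finset.mem_image.1 (Finset.mem_coe.1 ha)
    exact Nat.nth_mem_of_infinite hX i
  · intro a ha b hb hab
    obtain ⟨i, hi, rfl⟩ := Finset.mem_image.1 (Finset.mem_coe.1 hb)
    obtain ⟨j, rfl⟩ : ∃ j, Nat.nth (· ∈ X) j = a :=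
      (Set.ext_iff.1 (Nat.range_nth_of_infinite hX) a).2 ha
    refine Finset.mem_coe.2 (Finset.mem_image.2 ⟨j, Finset.mem_range.2 ?_, rfl⟩)
    exact ((Nat.nth_le_nth hX).1 hab).trans_lt (Finset.mem_range.1 hi)

theorem exists_mem_frontCarrier (hbad : ∀ m n, m < n → ¬ Lesssim r (x m) (x n)) {X : Set ℕ}
    (hX : X.Infinite) : ∃ σ ∈ frontCarrier r x, InitSeg (σ : Set ℕ) X := by
  classical
  have h := exists_isUr_descend hbad hX
  obtain ⟨σ, hσ, hσX⟩ := exists_initSeg_card hX (Nat.find h + 1)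
  refine ⟨σ, ⟨Nat.find h, hσ, ?_, fun j hj => ?_⟩, hσX⟩
  · rw [descend_congr hσX (by omega)]
    exact Nat.find_spec h
  · rw [descend_congr hσX (by omega)]
    exact Nat.find_min h hj

/-- The front of a bad sequence of sets. -/
noncomputable def front (hbad : ∀ m n, m < n → ¬ Lesssim r (x m) (x n)) (α : Ordinal.{u})
    (hx : ∀ n, (x n).IsUr ∨ rank (x n) < α) : BQO.Front.{u} where
  carrier := frontCarrier r x
  -- A nonempty node carries the rank of the last set it determines. The root determines none, and
  -- `α` exceeds the ranks of all sets `x n`.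
  rk σ := if σ.card = 0 then α else rank (descend r x (σ.card - 1) σ)
  infinite := by
    have h : ∀ n : ℕ, ∃ σ ∈ frontCarrier r x, σ.Nonempty ∧ sInf (σ : Set ℕ) = n := by
      intro n
      obtain ⟨σ, hσ, h⟩ := exists_mem_frontCarrier hbad (Set.Ici_infinite n)
      obtain ⟨k, hk, -⟩ := id hσ
      have hne : σ.Nonempty := Finset.card_pos.1 (by omega)
      exact ⟨σ, hσ, hne, (h.sInf_eq hne).trans csInf_Ici⟩
    choose g hg _ hg' using h
    exact Set.infinite_of_injective_forall_mem
      (fun m n hmn => (hg' m).symm.trans ((congrArg (fun σ : Finset ℕ => sInf (σ : Set ℕ)) hmn).trans (hg' n))) hg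
  antichain σ hσ τ hτ h := frontCarrier_antichain hσ hτ h
  exists_initSeg X hX _ := exists_mem_frontCarrier hbad hX
  rk_lt := by
    rintro σ τ - ⟨ρ, ⟨k, hk, -, hku⟩, hτρ, hne'⟩ h hne
    have hcard := h.card_lt hne
    have hcard' := hτρ.card_lt hne'
    have hX := BQO.infinite_extend τ
    have hτX := BQO.initSeg_extend (τ : Set ℕ)
    have hu : ¬ (descend r x (τ.card - 1) (BQO.extend τ)).IsUr := by
      rw [← descend_congr hτX (by omega), descend_congr hτρ (by omega)]
      exact hku _ (by omega)
    rw [if_neg (by omega : ¬ τ.card = 0), descend_congr hτX (by omega)]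
    split_ifs with h0
    · have h1 : rank (descend r x (τ.card - 1) (BQO.extend τ)) ≤
          rank (descend r x 0 (BQO.extend τ)) := by
        rcases Nat.eq_zero_or_pos (τ.card - 1) with h' | h'
        · rw [h']
        · exact (rank_descend_lt hbad hX h' hu).le
      refine h1.trans_lt ((hx _).resolve_left fun h' => hu ?_)
      rwa [descend_of_isUr (k := 0) h' (Nat.zero_le _)]
    · rw [descend_congr (h.trans hτX) (by omega)]
      exact rank_descend_lt hbad hX (by omega) hu

theorem exists_ur_eq : ∀ {a : PreUrset Q}, a.IsUr → ∃ q, a = ur q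
  | ur q, _ => ⟨q, rfl⟩
  | mk _ _, h => h.elim

/-- If there is no bad array of rank at most `α` in `Q`, then the sets of rank below `α` over `Q`
are well-quasi-ordered. -/
theorem partiallyWellOrderedOn_rank_lt [Preorder Q] {α : Ordinal.{u}}
    (hQ : ∀ F : BQO.Front.{u}, F.rk ∅ ≤ α → ∀ f : F.carrier → Q, ¬ BQO.IsBadArray F f) :
    {x : PreUrset Q | x.IsUr ∨ rank x < α}.PartiallyWellOrderedOn (Lesssim (· ≤ ·)) := by
  rw [Set.partiallyWellOrderedOn_iff_exists_lt]
  intro x hx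
  by_contra! hbad
  let F := front hbad α hx
  have hF : ∀ σ : F.carrier, ∃ q, descend (· ≤ ·) x (σ.1.card - 1) σ.1 = ur q := by
    rintro ⟨σ, k, hk, hku, -⟩
    refine exists_ur_eq ?_
    simpa [hk] using hku
  choose f hf using hF
  refine hQ F ?_ f fun σ τ h hle => ?_
  · simp [F, front]
  · obtain ⟨X, hX, hσX, hτX⟩ := h.exists_infinite
    have key : ∀ (σ : F.carrier) (X : Set ℕ), InitSeg (σ.1 : Set ℕ) X →
        ∀ K, σ.1.card ≤ K → descend (· ≤ ·) x K X = ur (f σ) := by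
      intro σ X hσX K hK
      have hpos : 0 < σ.1.card := by
        obtain ⟨k, hk, -⟩ := σ.2
        omega
      have h1 : descend (· ≤ ·) x (σ.1.card - 1) X = ur (f σ) := by
        rw [← descend_congr hσX (by omega), hf]
      rw [descend_of_isUr (k := σ.1.card - 1) (by rw [h1]; trivial) (by omega), h1]
    -- The descents along `X` and `tail X` are constant once they reach urelements, so one late
    -- common stage compares `f σ` with `f τ`.
    have := descend_bad hbad (max σ.1.card τ.1.card) hX
    rw [key σ X hσX _ (le_max_left _ _), key τ _ hτX _ (le_max_right _ _)] at this
    exact this hle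

end PreUrset

namespace BQO

/-! ### A partition theorem for fronts -/

namespace Front

/-- The base `⋃ F` of a front. -/
def base (F : Front.{u}) : Set ℕ := {n | ∃ σ ∈ F.carrier, n ∈ σ}

theorem infinite_base (F : Front.{u}) : F.base.Infinite := by
  intro h
  refine F.infinite ((h.toFinset.powerset.finite_toSet).subset fun σ hσ => ?_)
  exact Finset.mem_coe.2 (Finset.mem_powerset.2 fun n hn => h.mem_toFinset.2 ⟨σ, hσ, hn⟩)

theorem exists_mem_initSeg (F : Front.{u}) {X : Set ℕ} (hX : X.Infinite) (hXF : X ⊆ F.base) :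
    ∃ σ ∈ F.carrier, InitSeg (σ : Set ℕ) X :=
  F.exists_initSeg X hX fun _ hn => hXF hn

theorem empty_notMem (F : Front.{u}) : ∅ ∉ F.carrier := by
  intro h
  refine F.infinite ((Set.finite_singleton ∅).subset fun σ hσ => ?_)
  exact (F.antichain _ h σ hσ ⟨by simp, by simp⟩).symm

theorem eq_of_initSeg (F : Front.{u}) {σ τ : Finset ℕ} (hσ : σ ∈ F.carrier) (hτ : τ ∈ F.carrier)
    {X : Set ℕ} (h : InitSeg (σ : Set ℕ) X) (h' : InitSeg (τ : Set ℕ) X) : σ = τ := by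
  rcases h.comparable h' with h | h
  · exact F.antichain _ hσ _ hτ h
  · exact (F.antichain _ hτ _ hσ h).symm

/-- The restriction of a front to an infinite subset of its base. -/
def restrict (F : Front.{u}) (A : Set ℕ) (hA : A.Infinite) (hAF : A ⊆ F.base) : Front.{u} where
  carrier := {σ ∈ F.carrier | (σ : Set ℕ) ⊆ A}
  rk := F.rk
  infinite := by
    have h : ∀ n : A, ∃ σ, (σ ∈ F.carrier ∧ (σ : Set ℕ) ⊆ A) ∧ sInf (σ : Set ℕ) = n := by
      intro n
      have hX : (A ∩ Set.Ici n.1).Infinite := by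
        have := hA.sdiff (Set.finite_Iio n.1)
        rwa [Set.sdiff_eq, Set.compl_Iio] at this
      obtain ⟨σ, hσ, hσX⟩ := F.exists_mem_initSeg hX (Set.inter_subset_left.trans hAF)
      have hne : σ.Nonempty := Finset.nonempty_iff_ne_empty.2 fun h => F.empty_notMem (h ▸ hσ)
      refine ⟨σ, ⟨hσ, hσX.1.trans Set.inter_subset_left⟩, (hσX.sInf_eq hne).trans ?_⟩
      refine le_antisymm (Nat.sInf_le ⟨n.2, Set.mem_Ici.2 le_rfl⟩) ?_
      exact (Nat.sInf_mem hX.nonempty).2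
    choose g hg hg' using h
    have := hA.to_subtype
    refine Set.infinite_of_injective_forall_mem (f := g) (fun m n hmn => Subtype.ext ?_) hg
    rw [← hg' m, ← hg' n, hmn]
  antichain σ hσ τ hτ h := F.antichain σ hσ.1 τ hτ.1 h
  exists_initSeg X hX hXF := by
    have hXA : X ⊆ A := fun n hn => by
      obtain ⟨σ, hσ, hnσ⟩ := hXF n hn
      exact hσ.2 hnσ
    obtain ⟨σ, hσ, h⟩ := F.exists_mem_initSeg hX (hXA.trans hAF)
    exact ⟨σ, ⟨hσ, h.1.trans hXA⟩, h⟩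
  rk_lt := by
    rintro σ τ ⟨ρ, hρ, h⟩ ⟨ρ', hρ', h'⟩
    exact F.rk_lt σ τ ⟨ρ, hρ.1, h⟩ ⟨ρ', hρ'.1, h'⟩

end Front

/-- The infinite extensions of `σ` by subsets of `Y` all have the same colour. -/
def Homogeneous (g : Set ℕ → Prop) (σ : Finset ℕ) (Y : Set ℕ) : Prop :=
  ∀ Z Z' : Set ℕ, Z.Infinite → Z'.Infinite → Z ⊆ Y → Z' ⊆ Y →
    (g (σ ∪ Z) ↔ g (σ ∪ Z'))

/-- Fusion: in a decreasing sequence of sets `S i`, let `S (i + 1)` be homogeneous for `σ` extended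
by `n i = min (S i)`. The pigeonhole principle makes the resulting colours constant on infinitely
many `n i`, and the colour of `σ ∪ Z` is decided by the least element of `Z`. -/
theorem exists_homogeneous_of_insert {g : Set ℕ → Prop} {σ : Finset ℕ} {X : Set ℕ}
    (hX : X.Infinite)
    (h : ∀ n ∈ X, ∀ X' ⊆ X, X'.Infinite → (∀ m ∈ X', n < m) →
      ∃ Y ⊆ X', Y.Infinite ∧ Homogeneous g (insert n σ) Y) :
    ∃ Y ⊆ X, Y.Infinite ∧ Homogeneous g σ Y := by
  have hstep : ∀ S : {S : Set ℕ // S ⊆ X ∧ S.Infinite}, ∃ S' : {S : Set ℕ // S ⊆ X ∧ S.Infinite},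
      S'.1 ⊆ tail S.1 ∧ Homogeneous g (insert (sInf S.1) σ) S'.1 := by
    rintro ⟨S, hSX, hS⟩
    obtain ⟨Y, hY, hYi, hYh⟩ := h _ (hSX (Nat.sInf_mem hS.nonempty)) (tail S)
      (Set.sdiff_subset.trans hSX) (infinite_tail hS) fun m => sInf_lt_of_mem_tail
    exact ⟨⟨Y, hY.trans (Set.sdiff_subset.trans hSX), hYi⟩, hY, hYh⟩
  choose next hnext hhom using hstep
  let S : ℕ → {S : Set ℕ // S ⊆ X ∧ S.Infinite} := fun i => next^[i] ⟨X, subset_rfl, hX⟩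
  have hS : ∀ i, S (i + 1) = next (S i) := fun i => Function.iterate_succ_apply' _ _ _
  have hSanti : ∀ i j, i ≤ j → (S j).1 ⊆ (S i).1 := by
    intro i j hij
    induction j, hij using Nat.le_induction with
    | base => exact subset_rfl
    | succ j _ ih =>
      rw [hS]
      exact (hnext _).trans (Set.sdiff_subset.trans ih)
  let n : ℕ → ℕ := fun i => sInf (S i).1
  have hnS : ∀ i, n i ∈ (S i).1 := fun i => Nat.sInf_mem (S i).2.2.nonempty
  have hn : StrictMono n := strictMono_nat_of_lt_succ fun i =>
    sInf_lt_of_mem_tail (hnext (S i) (hS i ▸ hnS (i + 1)))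
  let c : ℕ → Prop := fun i => g (((insert (n i) σ : Finset ℕ) : Set ℕ) ∪ (S (i + 1)).1)
  obtain ⟨b, hb⟩ : ∃ b : Prop, {i | c i ↔ b}.Infinite := by
    by_contra! hfin
    refine Set.infinite_univ (α := ℕ) (((hfin True).union (hfin False)).subset
      fun i _ => ?_)
    by_cases hc : c i
    · exact .inl (by simpa using hc)
    · exact .inr (by simpa using hc)
  have key : ∀ Z : Set ℕ, Z.Infinite → Z ⊆ n '' {i | c i ↔ b} → (g (σ ∪ Z) ↔ b) := by
    intro Z hZ hZn
    obtain ⟨i, hi, hiZ⟩ := hZn (Nat.sInf_mem hZ.nonempty)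
    have htail : tail Z ⊆ (S (i + 1)).1 := by
      intro m hm
      obtain ⟨j, -, rfl⟩ := hZn hm.1
      have hij : i < j := hn.lt_iff_lt.1 (hiZ ▸ sInf_lt_of_mem_tail hm)
      exact hSanti _ _ hij (hnS j)
    have heq : (σ ∪ Z : Set ℕ) = ((insert (n i) σ : Finset ℕ) : Set ℕ) ∪ tail Z := by
      ext m
      have hmem := Nat.sInf_mem hZ.nonempty
      simp only [Finset.coe_insert, Set.mem_union, Set.mem_insert_iff, tail, Set.mem_sdiff,
        Set.mem_singleton_iff, hiZ]
      by_cases hm : m = sInf Z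
      · simp [hm, hmem]
      · simp [hm]
    rw [heq]
    refine (hhom (S i) _ _ (infinite_tail hZ) (S (i + 1)).2.2 (hS i ▸ htail)
      (hS i ▸ subset_rfl)).trans hi
  refine ⟨n '' {i | c i ↔ b}, ?_, hb.image hn.injective.injOn, fun Z Z' hZ hZ' h h' =>
    (key Z hZ h).trans (key Z' hZ' h').symm⟩
  rintro _ ⟨i, -, rfl⟩
  exact (S i).2.1 (hnS i)

theorem initSeg_union {σ : Finset ℕ} {X : Set ℕ} (h : ∀ n ∈ X, ∀ m ∈ σ, m < n) :
    InitSeg (σ : Set ℕ) (σ ∪ X) :=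
  ⟨Set.subset_union_left, fun _ hx y hy hxy =>
    hx.resolve_right fun hx => absurd (h _ hx y hy) (not_lt.2 hxy)⟩

/-- A colouring of the infinite subsets of the base of a front, which depends only on the initial
segment in the front, has an infinite homogeneous set. -/
theorem Front.exists_homogeneous (F : Front.{u}) (g : Set ℕ → Prop)
    (hg : ∀ σ ∈ F.carrier, ∀ X Y : Set ℕ, InitSeg (σ : Set ℕ) X → InitSeg (σ : Set ℕ) Y →
      (g X ↔ g Y)) :
    ∃ A ⊆ F.base, A.Infinite ∧ ∀ Z Z' : Set ℕ, Z.Infinite → Z'.Infinite → Z ⊆ A → Z' ⊆ A →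
      (g Z ↔ g Z') := by
  have hF : ∀ (σ : Finset ℕ) (X : Set ℕ), X.Infinite → X ⊆ F.base → (σ : Set ℕ) ⊆ F.base →
      (∀ n ∈ X, ∀ m ∈ σ, m < n) → (∃ ρ ∈ F.carrier, InitSeg (ρ : Set ℕ) σ) ∨
        ∃ ρ ∈ F.carrier, InitSeg (σ : Set ℕ) ρ ∧ σ ≠ ρ := by
    intro σ X hX hXF hσF h
    obtain ⟨ρ, hρ, hρX⟩ := F.exists_mem_initSeg (hX.mono Set.subset_union_right)
      (Set.union_subset hσF hXF)
    by_cases heq : σ = ρ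
    · exact .inl ⟨ρ, hρ, heq ▸ InitSeg.refl _⟩
    · exact (hρX.comparable (initSeg_union h)).imp (fun h => ⟨ρ, hρ, h⟩) fun h => ⟨ρ, hρ, h, heq⟩
  -- Induction on the rank of the node `σ`: a one-point extension either has an initial segment in
  -- the front, which fixes the colour, or is a node of smaller rank.
  have main : ∀ (o : Ordinal.{u}) (σ : Finset ℕ), F.rk σ = o → (σ : Set ℕ) ⊆ F.base →
      (∃ ρ ∈ F.carrier, InitSeg (σ : Set ℕ) ρ ∧ σ ≠ ρ) →
      ∀ X ⊆ F.base, X.Infinite → (∀ n ∈ X, ∀ m ∈ σ, m < n) →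
        ∃ Y ⊆ X, Y.Infinite ∧ Homogeneous g σ Y := by
    intro o
    induction o using WellFoundedLT.induction with | _ o ih => ?_
    intro σ hσo hσF hσT X hXF hX hσX
    refine exists_homogeneous_of_insert hX fun n hn X' hX'X hX' hnX' => ?_
    have hlt : ∀ k ∈ X', ∀ m ∈ insert n σ, m < k := by
      intro k hk m hm
      rcases Finset.mem_insert.1 hm with rfl | hm
      · exact hnX' k hk
      · exact hσX k (hX'X hk) m hm
    have hbase : ((insert n σ : Finset ℕ) : Set ℕ) ⊆ F.base := by
      rw [Finset.coe_insert]
      exact Set.insert_subset (hXF hn) hσF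
    rcases hF (insert n σ) X' hX' (hX'X.trans hXF) hbase hlt with ⟨ρ, hρ, h⟩ | hT
    · refine ⟨X', subset_rfl, hX', fun Z Z' _ _ hZ hZ' => hg ρ hρ _ _ ?_ ?_⟩
      · exact h.trans (initSeg_union fun k hk => hlt k (hZ hk))
      · exact h.trans (initSeg_union fun k hk => hlt k (hZ' hk))
    · refine ih _ ?_ _ rfl hbase hT X' (hX'X.trans hXF) hX' hlt
      have hnσ : n ∉ σ := fun h => lt_irrefl _ (hσX n hn n h)
      rw [← hσo]
      refine F.rk_lt _ _ hσT hT ?_ fun h => hnσ (h ▸ Finset.mem_insert_self _ _)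
      refine ⟨by simp, fun x hx y hy hxy => ?_⟩
      rcases Finset.mem_insert.1 (Finset.mem_coe.1 hx) with rfl | hx
      · exact absurd (hσX _ hn y hy) (not_lt.2 hxy)
      · exact hx
  obtain ⟨ρ, hρ⟩ := F.infinite.nonempty
  obtain ⟨A, hAF, hA, hhom⟩ := main _ ∅ rfl (by simp)
    ⟨ρ, hρ, ⟨by simp, by simp⟩, fun h => F.empty_notMem (h ▸ hρ)⟩ _ subset_rfl F.infinite_base
    (by simp)
  refine ⟨A, hAF, hA, fun Z Z' hZ hZ' h h' => ?_⟩
  simpa using hhom Z Z' hZ hZ' h h'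

/-- Converse to `Tri.exists_infinite` for elements of a front. -/
theorem Front.tri_of_initSeg (F : Front.{u}) {σ τ : Finset ℕ} (hσ : σ ∈ F.carrier)
    (hτ : τ ∈ F.carrier) {X : Set ℕ} (hX : X.Infinite) (h : InitSeg (σ : Set ℕ) X)
    (h' : InitSeg (τ : Set ℕ) (tail X)) : Tri σ τ := by
  have hσ' : σ.Nonempty := Finset.nonempty_iff_ne_empty.2 fun h => F.empty_notMem (h ▸ hσ)
  have hτ' : τ.Nonempty := Finset.nonempty_iff_ne_empty.2 fun h => F.empty_notMem (h ▸ hτ)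
  refine ⟨hσ', hτ', ?_, ?_⟩
  · rw [← sInf_coe, ← sInf_coe, h.sInf_eq hσ', h'.sInf_eq hτ']
    exact sInf_lt_sInf_tail hX
  · rw [← tail_coe]
    exact (h.tail hσ').comparable h'

/-- Adding a point that is incomparable to all elements creates no bad arrays of new ranks. -/
theorem not_isBadArray_sum {P : Type u} [Preorder P] {ζ : Ordinal.{u}} (hP : IsAlphaWqo P ζ)
    (F : Front.{u}) (hF : F.rk ∅ < ζ) (f : F.carrier → P ⊕ PUnit.{u + 1}) : ¬ IsBadArray F f := by
  intro hf
  let g : Set ℕ → Prop := fun X => ∃ σ : F.carrier, InitSeg (σ.1 : Set ℕ) X ∧ (f σ).isRight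
  have hg : ∀ (σ : F.carrier) (X : Set ℕ), InitSeg (σ.1 : Set ℕ) X → (g X ↔ (f σ).isRight) := by
    refine fun σ X hσ => ⟨?_, fun h => ⟨σ, hσ, h⟩⟩
    rintro ⟨τ, hτ, h⟩
    rwa [Subtype.ext (F.eq_of_initSeg σ.2 τ.2 hσ hτ)]
  obtain ⟨A, hAF, hA, hhom⟩ := F.exists_homogeneous g fun σ hσ X Y hX hY =>
    (hg ⟨σ, hσ⟩ X hX).trans (hg ⟨σ, hσ⟩ Y hY).symm
  -- If the new point is the homogeneous colour, two related elements of the front share that value,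
  -- against badness. Otherwise the restriction to `A` is a bad array into `P` with the same rank
  -- function.
  by_cases hgA : g A
  · obtain ⟨σ, hσ, hσA⟩ := F.exists_mem_initSeg hA hAF
    obtain ⟨τ, hτ, hτA⟩ := F.exists_mem_initSeg (infinite_tail hA)
      (Set.sdiff_subset.trans hAF)
    have h1 : (f ⟨σ, hσ⟩).isRight := (hg ⟨σ, hσ⟩ A hσA).1 hgA
    have h2 : (f ⟨τ, hτ⟩).isRight := (hg ⟨τ, hτ⟩ _ hτA).1
      ((hhom _ _ hA (infinite_tail hA) subset_rfl Set.sdiff_subset).1 hgA)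
    refine hf ⟨σ, hσ⟩ ⟨τ, hτ⟩ (F.tri_of_initSeg hσ hτ hA hσA hτA) ?_
    obtain ⟨a, ha⟩ := Sum.isRight_iff.1 h1
    obtain ⟨b, hb⟩ := Sum.isRight_iff.1 h2
    rw [ha, hb]
  · let G := F.restrict A hA hAF
    have hG : ∀ σ : G.carrier, ∃ p, f ⟨σ.1, σ.2.1⟩ = Sum.inl p := by
      rintro ⟨σ, hσ, hσA⟩
      rw [← Sum.isLeft_iff, ← Sum.not_isRight]
      have hX : (σ ∪ {n ∈ A | ∀ m ∈ σ, m < n} : Set ℕ).Infinite := by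
        refine Set.Infinite.mono Set.subset_union_right ?_
        refine (hA.sdiff (Set.finite_Iic (σ.sup id))).mono fun n hn => ⟨hn.1, fun m hm => ?_⟩
        exact (Finset.le_sup (f := id) hm).trans_lt (not_le.1 hn.2)
      have hσX := initSeg_union (σ := σ) (X := {n ∈ A | ∀ m ∈ σ, m < n}) fun n hn => hn.2
      have := (hhom _ _ hA hX subset_rfl (Set.union_subset hσA fun n hn => hn.1)).not.1 hgA
      rw [hg ⟨σ, hσ⟩ _ hσX] at this
      exact this
    choose f' hf' using hG
    refine hP.2 G hF f' fun σ τ h hle => hf ⟨σ.1, σ.2.1⟩ ⟨τ.1, τ.2.1⟩ h ?_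
    rw [hf', hf']
    exact Sum.inl_le_inl_iff.2 hle

end BQO

/-! ### Down-closed sets of words -/

namespace HigmanIdeal

variable {α : Type*}

/-- The factors of products of languages: at most one letter from a set, or an arbitrary word over
a set. -/
inductive Factor (α : Type*)
  | opt (D : Set α) : Factor α
  | star (D : Set α) : Factor α

/-- The set of letters of a factor. -/
def Factor.letters : Factor α → Set α
  | opt D => D
  | star D => D

/-- The product of a list of factors. -/
def lang : List (Factor α) → Set (List α)
  | [] => {[]}
  | .opt D :: w => {u | u ∈ lang w ∨ ∃ a ∈ D, ∃ u' ∈ lang w, u = a :: u'}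
  | .star D :: w => {u | ∃ l : List α, (∀ a ∈ l, a ∈ D) ∧ ∃ u' ∈ lang w, u = l ++ u'}

theorem lang_univ : lang [Factor.star (Set.univ : Set α)] = Set.univ :=
  Set.eq_univ_of_forall fun u => ⟨u, by simp, [], rfl, by simp⟩

theorem lang_append {w w' : List (Factor α)} :
    lang (w ++ w') = {u | ∃ u₁ ∈ lang w, ∃ u₂ ∈ lang w', u = u₁ ++ u₂} := by
  induction w with
  | nil =>
    ext u
    simp [lang]
  | cons F w ih =>
    ext u
    cases F with
    | opt D =>
      simp only [List.cons_append, lang, ih, Set.mem_ofPred_eq]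
      constructor
      · rintro (⟨u₁, h₁, u₂, h₂, rfl⟩ | ⟨a, ha, _, ⟨u₁, h₁, u₂, h₂, rfl⟩, rfl⟩)
        · exact ⟨u₁, .inl h₁, u₂, h₂, rfl⟩
        · exact ⟨a :: u₁, .inr ⟨a, ha, u₁, h₁, rfl⟩, u₂, h₂, rfl⟩
      · rintro ⟨_, h₁ | ⟨a, ha, u₁, h₁, rfl⟩, u₂, h₂, rfl⟩
        · exact .inl ⟨_, h₁, u₂, h₂, rfl⟩
        · exact .inr ⟨a, ha, _, ⟨u₁, h₁, u₂, h₂, rfl⟩, rfl⟩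
    | star D =>
      simp only [List.cons_append, lang, ih, Set.mem_ofPred_eq]
      constructor
      · rintro ⟨l, hl, _, ⟨u₁, h₁, u₂, h₂, rfl⟩, rfl⟩
        exact ⟨l ++ u₁, ⟨l, hl, u₁, h₁, rfl⟩, u₂, h₂, by simp⟩
      · rintro ⟨_, ⟨l, hl, u₁, h₁, rfl⟩, u₂, h₂, rfl⟩
        exact ⟨l, hl, u₁ ++ u₂, ⟨u₁, h₁, u₂, h₂, rfl⟩, by simp⟩

/-- A notion of largeness which passes to one of finitely many pieces. -/
structure IsPrime (C : Set (List α) → Prop) : Prop where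
  mono : ∀ A B, A ⊆ B → C A → C B
  union : ∀ A B, C (A ∪ B) → C A ∨ C B
  empty : ¬ C ∅

theorem IsPrime.exists_of_cover {C : Set (List α) → Prop} (hC : IsPrime C) {ι : Type*}
    (A : ι → Set (List α)) : ∀ (l : List ι), C {u | ∃ i ∈ l, u ∈ A i} → ∃ i ∈ l, C (A i)
  | [], h => (hC.empty (hC.mono _ _ (by simp) h)).elim
  | i :: l, h => by
    have h' : C (A i ∪ {u | ∃ i ∈ l, u ∈ A i}) := by
      refine hC.mono _ _ ?_ h
      rintro u ⟨j, hj, hu⟩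
      rcases List.mem_cons.1 hj with rfl | hj
      · exact .inl hu
      · exact .inr ⟨j, hj, hu⟩
    rcases hC.union _ _ h' with h | h
    · exact ⟨i, List.mem_cons_self .., h⟩
    · obtain ⟨j, hj, h⟩ := hC.exists_of_cover A l h
      exact ⟨j, List.mem_cons_of_mem _ hj, h⟩

/-! ### Embeddability of words and decomposition into products of ideals -/

variable [Preorder α]

/-- The embeddability order on words. -/
abbrev Embeds : List α → List α → Prop := List.SublistForall₂ (· ≤ ·)

theorem embeds_nil_iff {v : List α} : Embeds v [] ↔ v = [] := by
  constructor
  · rintro ⟨⟩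
    rfl
  · rintro rfl
    exact .nil

theorem embeds_cons_iff {v u : List α} {b : α} : Embeds v (b :: u) ↔
    Embeds v u ∨ ∃ a v', v = a :: v' ∧ a ≤ b ∧ Embeds v' u := by
  constructor
  · rintro (_ | ⟨h, h'⟩ | h)
    · exact .inl .nil
    · exact .inr ⟨_, _, rfl, h, h'⟩
    · exact .inl h
  · rintro (h | ⟨a, v', rfl, h, h'⟩)
    · exact .cons_right h
    · exact .cons h h'

theorem Embeds.append {s t s' t' : List α} (h : Embeds s t) (h' : Embeds s' t') :
    Embeds (s ++ s') (t ++ t') := by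
  induction h with
  | nil =>
    rename_i l
    induction l with
    | nil => exact h'
    | cons a l ih => exact .cons_right ih
  | cons h _ ih => exact .cons h ih
  | cons_right _ ih => exact .cons_right ih

/-- In a well-quasi-order, inclusion of down-closed sets is well-founded. -/
theorem wellFounded_lower {β : Type*} {r : β → β → Prop} (hr : WellQuasiOrdered r) :
    WellFounded fun A B : {A : Set β // ∀ a b, r a b → b ∈ A → a ∈ A} => A.1 ⊂ B.1 := by
  refine RelEmbedding.wellFounded_iff_isEmpty.2 ⟨fun f => ?_⟩
  have hf : ∀ m n, m < n → (f n).1 ⊂ (f m).1 := fun m n h => f.map_rel_iff.2 h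
  -- The points lost along a descending sequence would form a bad sequence.
  have h : ∀ n, ∃ a, a ∈ (f n).1 ∧ a ∉ (f (n + 1)).1 := fun n =>
    Set.exists_of_ssubset (hf n (n + 1) (Nat.lt_succ_self n))
  choose a ha ha' using h
  obtain ⟨m, n, hmn, hr⟩ := hr a
  refine ha' m ?_
  rcases Nat.lt_or_eq_of_le (Nat.succ_le_of_lt hmn) with h | h
  · exact (f (m + 1)).2 _ _ hr ((hf _ _ h).1 (ha n))
  · rw [Nat.succ_eq_add_one] at h
    exact (f (m + 1)).2 _ _ hr (h ▸ ha n)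

/-- A down-closed subset of a well-quasi-order is covered by finitely many directed down-closed
subsets. -/
theorem exists_directed_cover [WellQuasiOrderedLE α] (D : Set α) (hD : IsLowerSet D) :
    ∃ Js : List (Set α), (∀ J ∈ Js, J ⊆ D ∧ IsLowerSet J ∧ DirectedOn (· ≤ ·) J) ∧
      ∀ a ∈ D, ∃ J ∈ Js, a ∈ J := by
  suffices H : ∀ D : {A : Set α // ∀ a b, a ≤ b → b ∈ A → a ∈ A},
      ∃ Js : List (Set α), (∀ J ∈ Js, J ⊆ D.1 ∧ IsLowerSet J ∧ DirectedOn (· ≤ ·) J) ∧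
        ∀ a ∈ D.1, ∃ J ∈ Js, a ∈ J from H ⟨D, fun a b h hb => hD h hb⟩
  intro D
  induction D using (wellFounded_lower (wellQuasiOrdered_le (α := α))).induction with | _ D ih => ?_
  obtain ⟨D, hD⟩ := D
  by_cases hdir : DirectedOn (· ≤ ·) D
  · exact ⟨[D], by simpa using ⟨fun a b h hb => hD b a h hb, hdir⟩, by simp⟩
  · simp only [DirectedOn, not_forall, not_exists, not_and] at hdir
    obtain ⟨a, ha, b, hb, hab⟩ := hdir
    -- As `a` and `b` have no common upper bound in `D`, every element of `D` fails to be above one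
    -- of them; this splits `D` into two smaller down-closed sets.
    have hlow : ∀ c, ∀ x y, x ≤ y → y ∈ {y ∈ D | ¬ c ≤ y} → x ∈ {y ∈ D | ¬ c ≤ y} :=
      fun c x y hxy hy => ⟨hD x y hxy hy.1, fun h => hy.2 (h.trans hxy)⟩
    have hlt : ∀ c ∈ D, {y ∈ D | ¬ c ≤ y} ⊂ D := fun c hc =>
      ⟨fun y hy => hy.1, fun h => (h hc).2 le_rfl⟩
    obtain ⟨Js, hJs, hJs'⟩ := ih ⟨_, hlow a⟩ (hlt a ha)
    obtain ⟨Ks, hKs, hKs'⟩ := ih ⟨_, hlow b⟩ (hlt b hb)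
    refine ⟨Js ++ Ks, fun J hJ => ?_, fun y hy => ?_⟩
    · rcases List.mem_append.1 hJ with hJ | hJ
      · exact ⟨(hJs J hJ).1.trans (hlt a ha).1, (hJs J hJ).2⟩
      · exact ⟨(hKs J hJ).1.trans (hlt b hb).1, (hKs J hJ).2⟩
    · by_cases hay : a ≤ y
      · obtain ⟨J, hJ, h⟩ := hKs' y ⟨hy, hab y hy hay⟩
        exact ⟨J, List.mem_append_right _ hJ, h⟩
      · obtain ⟨J, hJ, h⟩ := hJs' y ⟨hy, hay⟩
        exact ⟨J, List.mem_append_left _ hJ, h⟩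

/-- All sets of letters are down-closed. -/
def IsLower (w : List (Factor α)) : Prop := ∀ F ∈ w, IsLowerSet F.letters

theorem IsLower.of_cons {F : Factor α} {w : List (Factor α)} (h : IsLower (F :: w)) : IsLower w :=
  fun G hG => h G (List.mem_cons_of_mem _ hG)

theorem lang_lower : ∀ {w : List (Factor α)}, IsLower w → ∀ {u v : List α}, Embeds v u →
    u ∈ lang w → v ∈ lang w
  | [], _, _, _, h, hu => by
    obtain rfl : _ = [] := hu
    exact embeds_nil_iff.1 h
  | .opt D :: w, hw, u, v, h, hu => by
    rcases hu with hu | ⟨a, ha, u, hu, rfl⟩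
    · exact .inl (lang_lower hw.of_cons h hu)
    · rcases embeds_cons_iff.1 h with h | ⟨b, v, rfl, hb, h⟩
      · exact .inl (lang_lower hw.of_cons h hu)
      · exact .inr ⟨b, hw _ (List.mem_cons_self ..) hb ha, v, lang_lower hw.of_cons h hu, rfl⟩
  | .star D :: w, hw, u, v, h, hu => by
    obtain ⟨l, hl, u, hu, rfl⟩ := hu
    induction l generalizing v with
    | nil => exact ⟨[], by simp, v, lang_lower hw.of_cons h hu, rfl⟩
    | cons a l ih =>
      rcases embeds_cons_iff.1 h with h | ⟨b, v, rfl, hb, h⟩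
      · exact ih _ (fun a ha => hl a (List.mem_cons_of_mem _ ha)) h
      · obtain ⟨l', hl', u', hu', rfl⟩ := ih _ (fun a ha => hl a (List.mem_cons_of_mem _ ha)) h
        refine ⟨b :: l', fun c hc => ?_, u', hu', rfl⟩
        rcases List.mem_cons.1 hc with rfl | hc
        · exact hw _ (List.mem_cons_self ..) hb (hl a (List.mem_cons_self ..))
        · exact hl' c hc

theorem isLowerSet_not_ge {D : Set α} (hD : IsLowerSet D) (a : α) :
    IsLowerSet {b ∈ D | ¬ a ≤ b} :=
  fun _ _ hxy hx => ⟨hD hxy hx.1, fun h => hx.2 (h.trans hxy)⟩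

/-- The words of a product that do not embed a given word are covered by finitely many products,
which consist of such words. -/
theorem exists_cover_not_embeds : ∀ (w : List (Factor α)), IsLower w → ∀ v : List α,
    ∃ ws : List (List (Factor α)),
      (∀ w' ∈ ws, IsLower w' ∧ ∀ u ∈ lang w', u ∈ lang w ∧ ¬ Embeds v u) ∧
      ∀ u ∈ lang w, ¬ Embeds v u → ∃ w' ∈ ws, u ∈ lang w'
  | w, _, [] => ⟨[], by simp, fun u _ h => (h .nil).elim⟩
  | [], _, a :: v => by
    refine ⟨[[]], ?_, fun u hu _ => ⟨[], by simp, hu⟩⟩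
    simp only [List.mem_singleton, forall_eq]
    refine ⟨by simp [IsLower], fun u hu => ⟨hu, fun h => ?_⟩⟩
    obtain rfl : u = [] := hu
    cases h
  | .opt D :: w, hw, a :: v => by
    obtain ⟨ws, hws, hws'⟩ := exists_cover_not_embeds w hw.of_cons (a :: v)
    obtain ⟨vs, hvs, hvs'⟩ := exists_cover_not_embeds w hw.of_cons v
    have hD : IsLowerSet D := hw _ (List.mem_cons_self ..)
    -- An optional letter above `a` can absorb the `a`, so the rest must avoid `v`; otherwise the
    -- rest must avoid all of `a :: v`.
    refine ⟨ws.map (.opt {b ∈ D | ¬ a ≤ b} :: ·) ++ vs.map (.opt D :: ·),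
      fun w' hw' => ?_, fun u hu hvu => ?_⟩
    · rw [List.mem_append] at hw'
      rcases hw' with hw' | hw'
      · rw [List.mem_map] at hw'
        obtain ⟨w', hw', rfl⟩ := hw'
        refine ⟨?_, ?_⟩
        · rintro F (_ | ⟨_, hF⟩)
          · exact isLowerSet_not_ge hD a
          · exact (hws w' hw').1 F hF
        · rintro u (hu | ⟨b, hb, u, hu, rfl⟩)
          · exact ⟨.inl ((hws w' hw').2 u hu).1, ((hws w' hw').2 u hu).2⟩
          · refine ⟨.inr ⟨b, hb.1, u, ((hws w' hw').2 u hu).1, rfl⟩, fun h => ?_⟩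
            rcases embeds_cons_iff.1 h with h | ⟨a', v', he, hb', h⟩
            · exact ((hws w' hw').2 u hu).2 h
            · cases he
              exact hb.2 hb'
      · rw [List.mem_map] at hw'
        obtain ⟨w', hw', rfl⟩ := hw'
        refine ⟨?_, ?_⟩
        · rintro F (_ | ⟨_, hF⟩)
          · exact hD
          · exact (hvs w' hw').1 F hF
        · rintro u (hu | ⟨b, hb, u, hu, rfl⟩)
          · refine ⟨.inl ((hvs w' hw').2 u hu).1, fun h => ((hvs w' hw').2 u hu).2 ?_⟩
            exact _root_.trans (List.tail_sublistForall₂_self (a :: v)) h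
          · refine ⟨.inr ⟨b, hb, u, ((hvs w' hw').2 u hu).1, rfl⟩, fun h => ?_⟩
            rcases embeds_cons_iff.1 h with h | ⟨a', v', he, hb', h⟩
            · exact ((hvs w' hw').2 u hu).2
                (_root_.trans (List.tail_sublistForall₂_self (a :: v)) h)
            · cases he
              exact ((hvs w' hw').2 u hu).2 h
    · rcases hu with hu | ⟨b, hb, u, hu, rfl⟩
      · obtain ⟨w', hw', h⟩ := hws' u hu hvu
        exact ⟨_, List.mem_append_left _ (List.mem_map_of_mem hw'), .inl h⟩
      · by_cases hab : a ≤ b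
        · obtain ⟨w', hw', h⟩ := hvs' u hu fun h => hvu (.cons hab h)
          exact ⟨_, List.mem_append_right _ (List.mem_map_of_mem hw'),
            .inr ⟨b, hb, u, h, rfl⟩⟩
        · obtain ⟨w', hw', h⟩ := hws' u hu fun h => hvu (.cons_right h)
          exact ⟨_, List.mem_append_left _ (List.mem_map_of_mem hw'),
            .inr ⟨b, ⟨hb, hab⟩, u, h, rfl⟩⟩
  | .star D :: w, hw, a :: v => by
    obtain ⟨ws, hws, hws'⟩ := exists_cover_not_embeds w hw.of_cons (a :: v)
    obtain ⟨vs, hvs, hvs'⟩ := exists_cover_not_embeds (.star D :: w) hw v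
    have hD : IsLowerSet D := hw _ (List.mem_cons_self ..)
    have hskip : ∀ (l : List α) (u : List α), (∀ b ∈ l, b ∈ {b ∈ D | ¬ a ≤ b}) →
        Embeds (a :: v) (l ++ u) → Embeds (a :: v) u := by
      intro l u hl h
      induction l with
      | nil => exact h
      | cons b l ih =>
        refine ih (fun c hc => hl c (List.mem_cons_of_mem _ hc)) ?_
        rcases embeds_cons_iff.1 h with h | ⟨a', v', he, hb', h⟩
        · exact h
        · cases he
          exact absurd hb' (hl b (List.mem_cons_self ..)).2
    -- Split the starred part at its first letter above `a`, if there is one: what follows that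
    -- letter must avoid `v`. The letter itself ranges over all of `D`, which keeps the factor
    -- down-closed.
    refine ⟨ws.map (.star {b ∈ D | ¬ a ≤ b} :: ·) ++
      vs.map fun w' => .star {b ∈ D | ¬ a ≤ b} :: .opt D :: w', fun w' hw' => ?_, ?_⟩
    · rw [List.mem_append] at hw'
      rcases hw' with hw' | hw'
      · rw [List.mem_map] at hw'
        obtain ⟨w', hw', rfl⟩ := hw'
        refine ⟨?_, ?_⟩
        · rintro F (_ | ⟨_, hF⟩)
          · exact isLowerSet_not_ge hD a
          · exact (hws w' hw').1 F hF
        · rintro u ⟨l, hl, u, hu, rfl⟩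
          exact ⟨⟨l, fun b hb => (hl b hb).1, u, ((hws w' hw').2 u hu).1, rfl⟩,
            fun h => ((hws w' hw').2 u hu).2 (hskip l u hl h)⟩
      · rw [List.mem_map] at hw'
        obtain ⟨w', hw', rfl⟩ := hw'
        refine ⟨?_, ?_⟩
        · rintro F (_ | ⟨_, _ | ⟨_, hF⟩⟩)
          · exact isLowerSet_not_ge hD a
          · exact hD
          · exact (hvs w' hw').1 F hF
        · have hv : ∀ u ∈ lang w', ¬ Embeds (a :: v) u := fun u hu h =>
            ((hvs w' hw').2 u hu).2 (_root_.trans (List.tail_sublistForall₂_self (a :: v)) h)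
          rintro u ⟨l, hl, u, hu, rfl⟩
          rcases hu with hu | ⟨b, hb, u, hu, rfl⟩
          · obtain ⟨l', hl', u', hu', rfl⟩ := ((hvs w' hw').2 u hu).1
            refine ⟨⟨l ++ l', fun c hc => ?_, u', hu', by simp⟩, fun h => hv _ hu (hskip l _ hl h)⟩
            rcases List.mem_append.1 hc with hc | hc
            · exact (hl c hc).1
            · exact hl' c hc
          · obtain ⟨l', hl', u', hu', rfl⟩ := ((hvs w' hw').2 u hu).1
            refine ⟨⟨l ++ b :: l', fun c hc => ?_, u', hu', by simp⟩, fun h => ?_⟩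
            · rcases List.mem_append.1 hc with hc | hc
              · exact (hl c hc).1
              · rcases List.mem_cons.1 hc with rfl | hc
                · exact hb
                · exact hl' c hc
            · rcases embeds_cons_iff.1 (hskip l _ hl h) with h | ⟨a', v', he, -, h⟩
              · exact hv _ hu h
              · cases he
                exact ((hvs w' hw').2 _ hu).2 h
    · rintro u ⟨l, hl, u, hu, rfl⟩ hvu
      suffices H : ∀ l : List α, (∀ b ∈ l, b ∈ D) → ¬ Embeds (a :: v) (l ++ u) →
          (∃ w' ∈ ws, l ++ u ∈ lang (.star {b ∈ D | ¬ a ≤ b} :: w')) ∨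
          ∃ w' ∈ vs, l ++ u ∈ lang (.star {b ∈ D | ¬ a ≤ b} :: .opt D :: w') by
        rcases H l hl hvu with ⟨w', hw', h⟩ | ⟨w', hw', h⟩
        · exact ⟨_, List.mem_append_left _ (List.mem_map_of_mem hw'), h⟩
        · exact ⟨_, List.mem_append_right _ (List.mem_map_of_mem hw'), h⟩
      clear hvu hl l
      intro l hl hvu
      induction l with
      | nil =>
        obtain ⟨w', hw', h⟩ := hws' u hu hvu
        exact .inl ⟨w', hw', [], by simp, u, h, rfl⟩
      | cons b l ih =>
        have hl' : ∀ b ∈ l, b ∈ D := fun c hc => hl c (List.mem_cons_of_mem _ hc)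
        have hb : b ∈ D := hl b (List.mem_cons_self ..)
        by_cases hab : a ≤ b
        · obtain ⟨w', hw', h⟩ := hvs' (l ++ u) ⟨l, hl', u, hu, rfl⟩ fun h => hvu (.cons hab h)
          exact .inr ⟨w', hw', [], by simp, _, .inr ⟨b, hb, _, h, rfl⟩, rfl⟩
        · have hcons : ∀ w', l ++ u ∈ lang (.star {b ∈ D | ¬ a ≤ b} :: w') →
              b :: l ++ u ∈ lang (.star {b ∈ D | ¬ a ≤ b} :: w') := by
            rintro w' ⟨l', hl', u', hu', h⟩
            refine ⟨b :: l', fun c hc => ?_, u', hu', by simp [h]⟩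
            rcases List.mem_cons.1 hc with rfl | hc
            · exact ⟨hb, hab⟩
            · exact hl' c hc
          exact (ih hl' fun h => hvu (.cons_right h)).imp
            (fun ⟨w', hw', h⟩ => ⟨w', hw', hcons _ h⟩) fun ⟨w', hw', h⟩ => ⟨w', hw', hcons _ h⟩

theorem wellQuasiOrdered_embeds [WellQuasiOrderedLE α] :
    WellQuasiOrdered (Embeds : List α → List α → Prop) := by
  have h := Set.PartiallyWellOrderedOn.partiallyWellOrderedOn_sublistForall₂ (α := α) (· ≤ ·)
    (s := Set.univ) (Set.partiallyWellOrderedOn_univ_iff.2 wellQuasiOrdered_le)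
  exact Set.partiallyWellOrderedOn_univ_iff.1 (by simpa using h)

/-- A large down-closed set of words contains a large product. -/
theorem exists_lang_subset [WellQuasiOrderedLE α] {C : Set (List α) → Prop} (hC : IsPrime C)
    {L : Set (List α)} (hL : ∀ u v, Embeds v u → u ∈ L → v ∈ L) (hCL : C L) :
    ∃ w, IsLower w ∧ lang w ⊆ L ∧ C (lang w) := by
  suffices H : ∀ A : {A : Set (List α) // ∀ a b, Embeds a b → b ∈ A → a ∈ A},
      ∀ w, IsLower w → lang w = A.1 → C (A.1 ∩ L) → ∃ w, IsLower w ∧ lang w ⊆ L ∧ C (lang w) by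
    refine H ⟨Set.univ, by simp⟩ [.star Set.univ] ?_ lang_univ (by simpa using hCL)
    rintro F (_ | ⟨_, ⟨⟩⟩)
    exact isLowerSet_univ
  intro A
  induction A using (wellFounded_lower (wellQuasiOrdered_embeds (α := α))).induction with
  | _ A ih => ?_
  rintro w hw hwA hCA
  by_cases hsub : lang w ⊆ L
  · exact ⟨w, hw, hsub, hC.mono _ _ (by rw [hwA]; exact Set.inter_subset_left) hCA⟩
  -- Words of `L` cannot embed `v`, since `L` is down-closed. So the finitely many products avoiding
  -- `v` cover the part of `lang w` in `L`; one of them meets `L` in a large set, and it is strictly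
  -- smaller because it omits `v`.
  · obtain ⟨v, hv, hvL⟩ := Set.not_subset.1 hsub
    obtain ⟨ws, hws, hws'⟩ := exists_cover_not_embeds w hw v
    obtain ⟨w', hw', h⟩ := hC.exists_of_cover (fun w' => lang w' ∩ L) ws (hC.mono _ _ (by
      rintro u ⟨huA, huL⟩
      obtain ⟨w', hw', h⟩ := hws' u (hwA ▸ huA) fun h => hvL (hL u v h huL)
      exact ⟨w', hw', h, huL⟩) hCA)
    refine ih ⟨lang w', fun a b h hb => lang_lower (hws w' hw').1 h hb⟩ ?_ w' (hws w' hw').1 rfl h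
    refine ⟨fun u hu => hwA ▸ ((hws w' hw').2 u hu).1, fun h => ?_⟩
    exact ((hws w' hw').2 v (h (hwA ▸ hv))).2 (List.SublistForall₂.is_refl.refl v)

/-- The factors whose sets of words are ideals: at most one letter from a directed down-closed set,
or arbitrary words over a down-closed set. -/
def Factor.IsIdeal : Factor α → Prop
  | opt D => IsLowerSet D ∧ DirectedOn (· ≤ ·) D
  | star D => IsLowerSet D

/-- A large product contains a large product of ideals. -/
theorem exists_isIdeal_lang_subset [WellQuasiOrderedLE α] {C : Set (List α) → Prop}
    (hC : IsPrime C) (w : List (Factor α)) : ∀ v : List (Factor α), IsLower w →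
    C (lang (v ++ w)) → ∃ w', (∀ F ∈ w', F.IsIdeal) ∧ lang w' ⊆ lang w ∧ C (lang (v ++ w')) := by
  -- The prefix `v` collects the factors already replaced by ideals.
  induction w with
  | nil => exact fun v _ h => ⟨[], by simp, subset_rfl, h⟩
  | cons F w ih =>
    intro v hw h
    have hF := hw F (List.mem_cons_self ..)
    suffices H : ∃ G : Factor α, G.IsIdeal ∧ (∀ w, lang (G :: w) ⊆ lang (F :: w)) ∧
        C (lang (v ++ G :: w)) by
      obtain ⟨G, hG, hGF, hC'⟩ := H
      obtain ⟨w', hw', hw'', h'⟩ := ih (v ++ [G]) hw.of_cons (by simpa using hC')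
      refine ⟨G :: w', ?_, (hGF w').trans ?_, by simpa using h'⟩
      · rintro G' (_ | ⟨_, h⟩)
        · exact hG
        · exact hw' G' h
      · rw [← List.singleton_append, ← List.singleton_append (l := w), lang_append, lang_append]
        rintro _ ⟨u₁, h₁, u₂, h₂, rfl⟩
        exact ⟨u₁, h₁, u₂, hw'' h₂, rfl⟩
    cases F with
    | star D => exact ⟨.star D, hF, fun _ => subset_rfl, h⟩
    | opt D =>
      obtain ⟨Js, hJs, hJs'⟩ := exists_directed_cover D hF
      -- The piece `∅` takes care of words skipping this letter, as `Js` may be empty.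
      obtain ⟨J, hJ, h'⟩ := hC.exists_of_cover (fun J => lang (v ++ .opt J :: w)) (∅ :: Js)
        (hC.mono _ _ (by
          intro u hu
          rw [lang_append] at hu
          obtain ⟨u₁, h₁, _, h₂ | ⟨a, ha, u₂, h₂, rfl⟩, rfl⟩ := hu
          · refine ⟨∅, List.mem_cons_self .., ?_⟩
            rw [lang_append]
            exact ⟨u₁, h₁, _, .inl h₂, rfl⟩
          · obtain ⟨J, hJ, haJ⟩ := hJs' a ha
            refine ⟨J, List.mem_cons_of_mem _ hJ, ?_⟩
            rw [lang_append]
            exact ⟨u₁, h₁, _, .inr ⟨a, haJ, u₂, h₂, rfl⟩, rfl⟩) h)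
      have hJ' : J ⊆ D ∧ IsLowerSet J ∧ DirectedOn (· ≤ ·) J := by
        rcases List.mem_cons.1 hJ with rfl | hJ
        · exact ⟨Set.empty_subset _, isLowerSet_empty, fun _ h => h.elim⟩
        · exact hJs J hJ
      refine ⟨.opt J, hJ'.2, fun w => ?_, h'⟩
      rintro u (hu | ⟨a, ha, u, hu, rfl⟩)
      · exact .inl hu
      · exact .inr ⟨a, hJ'.1 ha, u, hu, rfl⟩

end HigmanIdeal

/-! ### Words of codes -/

/-- Hereditarily nonempty sets over `P`, which serve as generalized letters. -/
inductive Letter (P : Type u) : Type (u + 1)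
  | ur (p : P) : Letter P
  -- An empty set would lie below everything, including the mark; nonemptiness is what makes
  -- `Letter.not_le_mark` true.
  | mk (ι : Type u) (h : Nonempty ι) (f : ι → Letter P) : Letter P

/-- Codes of indecomposable ideals of words: letters, and the sets of all words over a set of
codes. -/
inductive Code (P : Type u) : Type (u + 1)
  | letter (a : Letter P) : Code P
  | star (ι : Type u) (h : Nonempty ι) (f : ι → Code P) : Code P

variable {P : Type u}

open PreUrset (Lesssim UrLesssim)
open HigmanIdeal (Embeds)

/-- A letter as a set. -/
def Letter.toSet : Letter P → PreUrset (P ⊕ PUnit.{u + 1})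
  | ur p => .ur (.inl p)
  | mk ι _ f => .mk ι fun i => (f i).toSet

/-- A code as a set, in which the codes `star` are marked by an additional urelement. -/
def Code.toSet : Code P → PreUrset (P ⊕ PUnit.{u + 1})
  | letter a => a.toSet
  -- Because of the mark no `star` code lies below a letter. This is needed since letters unfold to
  -- at most one code, and `star` codes to words of every length.
  | star ι _ f => .mk (Option ι) fun o => o.elim (.ur (.inr ⟨⟩)) fun i => (f i).toSet

/-- One step of unfolding a code into a word of simpler codes. -/
inductive CodeStep : Code P → List (Code P) → Prop
  -- A point unfolds only to itself, matching the identification of an urelement with its singleton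
  -- in `≲*`.
  | ur (p : P) : CodeStep (.letter (.ur p)) [.letter (.ur p)]
  | nil (ι : Type u) (h : Nonempty ι) (f : ι → Letter P) : CodeStep (.letter (.mk ι h f)) []
  | mk (ι : Type u) (h : Nonempty ι) (f : ι → Letter P) (i : ι) :
    CodeStep (.letter (.mk ι h f)) [.letter (f i)]
  | star (ι : Type u) (h : Nonempty ι) (f : ι → Code P) (l : List ι) :
    CodeStep (.star ι h f) (l.map f)

/-- One step of unfolding all codes in a word. -/
inductive WordStep : List (Code P) → List (Code P) → Prop
  | nil : WordStep [] []
  | cons {c : Code P} {u w w' : List (Code P)} : CodeStep c u → WordStep w w' →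
    WordStep (c :: w) (u ++ w')

/-- A sequence over `P` as a word of codes. -/
def urWord (s : List P) : List (Code P) := s.map fun p => .letter (.ur p)

theorem CodeStep.exists : ∀ c : Code P, ∃ u, CodeStep c u
  | .letter (.ur p) => ⟨_, .ur p⟩
  | .letter (.mk ι h f) => ⟨_, .nil ι h f⟩
  | .star ι h f => ⟨_, .star ι h f []⟩

theorem WordStep.exists : ∀ w : List (Code P), ∃ w', WordStep w w'
  | [] => ⟨_, .nil⟩
  | c :: w => let ⟨_, hu⟩ := CodeStep.exists c
    let ⟨_, hw'⟩ := WordStep.exists w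
    ⟨_, .cons hu hw'⟩

theorem WordStep.append {a a' b b' : List (Code P)} (h : WordStep a a') (h' : WordStep b b') :
    WordStep (a ++ b) (a' ++ b') := by
  induction h with
  | nil => exact h'
  | cons h _ ih =>
    rw [List.append_assoc]
    exact .cons h ih

theorem WordStep.exists_of_append {a b w : List (Code P)} (h : WordStep (a ++ b) w) :
    ∃ a' b', WordStep a a' ∧ WordStep b b' ∧ w = a' ++ b' := by
  induction a generalizing w with
  | nil => exact ⟨[], w, .nil, h, rfl⟩
  | cons c a ih =>
    cases h with
    | cons hc h =>
      obtain ⟨a', b', ha, hb, rfl⟩ := ih h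
      exact ⟨_, b', .cons hc ha, hb, by simp⟩

theorem WordStep.eq_urWord {s : List P} {w : List (Code P)} (h : WordStep (urWord s) w) :
    w = urWord s := by
  induction s generalizing w with
  | nil =>
    cases h
    rfl
  | cons p s ih =>
    cases h with
    | cons hc h =>
      cases hc
      rw [ih h]
      rfl

/-- Repetitions of codes `star` in a word. -/
inductive Pump : List (Code P) → List (Code P) → Prop
  | nil : Pump [] []
  | cons (c : Code P) {u v : List (Code P)} : Pump u v → Pump (c :: u) (c :: v)
  | star (ι : Type u) (h : Nonempty ι) (f : ι → Code P) (k : ℕ) {u v : List (Code P)} :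
    Pump u v → Pump (.star ι h f :: u) (List.replicate k (.star ι h f) ++ v)

theorem Pump.refl : ∀ u : List (Code P), Pump u u
  | [] => .nil
  | c :: u => .cons c (Pump.refl u)

theorem Pump.append {a a' b b' : List (Code P)} (h : Pump a a') (h' : Pump b b') :
    Pump (a ++ b) (a' ++ b') := by
  induction h with
  | nil => exact h'
  | cons c _ ih => exact .cons c ih
  | star ι h f k _ ih =>
    rw [List.append_assoc]
    exact .star ι h f k ih

theorem Pump.eq_urWord {s : List P} {w : List (Code P)} (h : Pump (urWord s) w) :
    w = urWord s := by
  induction s generalizing w with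
  | nil =>
    cases h
    rfl
  | cons p s ih =>
    cases h with
    | cons _ h =>
      rw [ih h]
      rfl

theorem WordStep.exists_of_replicate {ι : Type u} {h : Nonempty ι} {f : ι → Code P} {k : ℕ}
    {w : List (Code P)} (hw : WordStep (List.replicate k (.star ι h f)) w) :
    ∃ l : List ι, w = l.map f := by
  induction k generalizing w with
  | zero =>
    cases hw
    exact ⟨[], rfl⟩
  | succ k ih =>
    cases hw with
    | cons hc hw =>
      obtain ⟨l, rfl⟩ := ih hw
      cases hc with
      | star _ _ _ l' => exact ⟨l' ++ l, by simp⟩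

/-- Concatenating words over one set gives a word over that set, so repeating a `star` code yields
no new unfoldings. -/
theorem Pump.wordStep {u v v' : List (Code P)} (h : Pump u v) (hv : WordStep v v') :
    WordStep u v' := by
  induction h generalizing v' with
  | nil => exact hv
  | cons c _ ih =>
    cases hv with
    | cons hc hv => exact .cons hc (ih hv)
  | star ι h f k _ ih =>
    obtain ⟨a, b, ha, hb, rfl⟩ := hv.exists_of_append
    obtain ⟨l, rfl⟩ := ha.exists_of_replicate
    exact .cons (.star ι h f l) (ih hb)

/-! ### The order on codes and its compatibility with unfolding and pumping -/

section Order

variable [Preorder P]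

instance : Preorder (Code P) where
  le c d := Lesssim (· ≤ ·) c.toSet d.toSet
  le_refl c := Lesssim.refl _
  le_trans _ _ _ := Lesssim.trans

theorem Letter.not_le_mark : ∀ a : Letter P, ¬ Lesssim (· ≤ ·) a.toSet (.ur (.inr ⟨⟩))
  | ur _ => fun h => Sum.not_inl_le_inr h
  | mk _ ⟨i⟩ f => fun h => Letter.not_le_mark (f i) (h i)

theorem Code.not_le_mark : ∀ c : Code P, ¬ Lesssim (· ≤ ·) c.toSet (.ur (.inr ⟨⟩))
  | letter a => a.not_le_mark
  | star _ ⟨i⟩ f => fun h => Code.not_le_mark (f i) (h (some i))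

theorem Letter.not_mark_le : ∀ a : Letter P, ¬ UrLesssim (· ≤ ·) (.inr ⟨⟩) a.toSet
  | ur _ => fun h => Sum.not_inr_le_inl h
  | mk _ _ f => fun ⟨i, h⟩ => Letter.not_mark_le (f i) h

theorem Code.not_star_le_letter {ι : Type u} {h : Nonempty ι} {f : ι → Code P} :
    ∀ {a : Letter P}, ¬ Code.star ι h f ≤ .letter a
  | .ur p => fun hle => Letter.not_mark_le (.ur p) (hle none)
  | .mk _ _ g => fun hle => let ⟨j, hj⟩ := hle none; Letter.not_mark_le (g j) hj

/-- A letter below a `star` code is matched by a word of length at most one. The problematic case, a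
`star` code below a letter, is ruled out by the mark. -/
theorem CodeStep.simulate {c d : Code P} {u : List (Code P)} (hcd : c ≤ d) (hu : CodeStep c u) :
    ∃ v, CodeStep d v ∧ Embeds u v := by
  have hsingle : ∀ {c d : Code P}, c ≤ d → Embeds [c] [d] := fun h => .cons h .nil
  cases hu with
  | ur p =>
    match d, hcd with
    | .letter (.ur q), hcd => exact ⟨_, .ur q, hsingle hcd⟩
    | .letter (.mk ι h g), ⟨j, hj⟩ => exact ⟨_, .mk ι h g j, hsingle hj⟩
    | .star ι h g, ⟨none, hj⟩ => exact (Sum.not_inl_le_inr hj).elim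
    | .star ι h g, ⟨some j, hj⟩ => exact ⟨_, .star ι h g [j], hsingle hj⟩
  | nil => exact (CodeStep.exists d).imp fun _ h => ⟨h, .nil⟩
  | mk κ hκ f i =>
    match d, hcd with
    | .letter (.ur q), hcd => exact ⟨_, .ur q, hsingle (hcd i)⟩
    | .letter (.mk ι h g), hcd =>
      obtain ⟨j, hj⟩ := hcd i
      exact ⟨_, .mk ι h g j, hsingle hj⟩
    | .star ι h g, hcd =>
      match hcd i with
      | ⟨none, hj⟩ => exact (Letter.not_le_mark _ hj).elim
      | ⟨some j, hj⟩ => exact ⟨_, .star ι h g [j], hsingle hj⟩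
  | star κ hκ f l =>
    match d, hcd with
    | .letter a, hcd => exact (Code.not_star_le_letter hcd).elim
    | .star ι h g, hcd =>
      have hj : ∀ i, ∃ j, f i ≤ g j := fun i =>
        match hcd (some i) with
        | ⟨none, hj⟩ => (Code.not_le_mark _ hj).elim
        | ⟨some j, hj⟩ => ⟨j, hj⟩
      choose j hj using hj
      refine ⟨_, .star ι h g (l.map j), ?_⟩
      induction l with
      | nil => exact .nil
      | cons i l ih => exact .cons (hj i) ih

theorem WordStep.simulate {w v w' : List (Code P)} (h : Embeds w v) (hw : WordStep w w') :
    ∃ v', WordStep v v' ∧ Embeds w' v' := by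
  induction h generalizing w' with
  | nil =>
    cases hw
    exact (WordStep.exists _).imp fun _ h => ⟨h, .nil⟩
  | cons hcd _ ih =>
    cases hw with
    | cons hc hw =>
      obtain ⟨v', hv', h⟩ := ih hw
      obtain ⟨u, hu, h'⟩ := hc.simulate hcd
      exact ⟨_, .cons hu hv', h'.append h⟩
  | cons_right _ ih =>
    obtain ⟨v', hv', h⟩ := ih hw
    rename_i d _ _ _
    obtain ⟨u, hu⟩ := CodeStep.exists d
    exact ⟨_, .cons hu hv', Embeds.append (s := []) .nil h⟩

theorem embeds_urWord {s t : List P} : Embeds (urWord s) (urWord t) ↔ SeqEmbed P s t := by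
  rw [urWord, urWord, Embeds, List.sublistForall₂_map_left_iff, List.sublistForall₂_map_right_iff,
    SeqEmbed]
  have : (fun a b : P => Code.letter (.ur a) ≤ Code.letter (.ur b)) = (· ≤ ·) := by
    ext a b
    exact Sum.inl_le_inl_iff
  rw [this]

theorem embeds_replicate {c d : Code P} (h : c ≤ d) (k : ℕ) :
    Embeds (List.replicate k c) (List.replicate k d) := by
  induction k with
  | zero => exact .nil
  | succ k ih => exact .cons h ih

/-- A code above a `star` code is again a `star` code, so it can be repeated equally often. -/
theorem Pump.simulate {u v w : List (Code P)} (h : Embeds u v) (hu : Pump u w) :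
    ∃ w', Pump v w' ∧ Embeds w w' := by
  induction h generalizing w with
  | nil =>
    cases hu
    exact ⟨_, Pump.refl _, .nil⟩
  | cons hcd _ ih =>
    rename_i c d _ _ _
    cases hu with
    | cons _ hu =>
      obtain ⟨w', hw', h⟩ := ih hu
      exact ⟨_, .cons _ hw', .cons hcd h⟩
    | star ι hι f k hu =>
      obtain ⟨w', hw', h⟩ := ih hu
      match d, hcd with
      | .letter a, hcd => exact (Code.not_star_le_letter hcd).elim
      | .star κ hκ g, hcd =>
        exact ⟨_, .star κ hκ g k hw', (embeds_replicate hcd k).append h⟩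
  | cons_right _ ih =>
    obtain ⟨w', hw', h⟩ := ih hu
    exact ⟨_, .cons _ hw', .cons_right h⟩

end Order

/-! ### Transitivity, comparison with urelements, and smallness in `V(Q)` -/

namespace Urset

variable {Q : Type u} {r : Q → Q → Prop}

theorem Lesssim.trans [IsTrans Q r] {x y z : Urset Q} (h : Lesssim r x y) (h' : Lesssim r y z) :
    Lesssim r x z := by
  induction x using Quotient.inductionOn with | _ x => ?_
  induction y using Quotient.inductionOn with | _ y => ?_
  induction z using Quotient.inductionOn with | _ z => ?_
  exact PreUrset.Lesssim.trans h h'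

theorem ur_lesssim_iff {p : Q} {y : Urset Q} (hy : ¬ IsUr y) :
    Lesssim r (ur p) y ↔ ∃ y' ∈ elems y, Lesssim r (ur p) y' := by
  obtain ⟨s, hs, hs'⟩ := exists_elems_eq ({ur p} : Set (Urset Q))
  rw [lesssim_ur_set r (x := ur p) trivial hy hs hs', lesssim_set_set r hs hy, hs']
  simp

theorem lesssim_ur_iff {x : Urset Q} {q : Q} (hx : ¬ IsUr x) :
    Lesssim r x (ur q) ↔ ∀ x' ∈ elems x, Lesssim r x' (ur q) := by
  obtain ⟨s, hs, hs'⟩ := exists_elems_eq ({ur q} : Set (Urset Q))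
  rw [lesssim_set_ur r (y := ur q) hx trivial hs hs', lesssim_set_set r hx hs, hs']
  simp

theorem small_elems (x : Urset Q) : Small.{u} (elems x) := by
  induction x using Quotient.inductionOn with | _ x => ?_
  cases x with
  | ur q =>
    have : elems (Quotient.mk (PreUrset.setoid Q) (.ur q)) = ∅ :=
      elems_eq_empty_of_isUr (x := ur q) trivial
    rw [this]
    infer_instance
  | mk ι f =>
    let g : ι → Urset Q := fun i => Quotient.mk _ (f i)
    have hg : Small.{u} (Set.range g) := small_range g
    refine @small_subset _ _ _ (fun y hy => ?_) hg
    induction y using Quotient.inductionOn with | _ y => ?_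
    obtain ⟨i, hi⟩ := hy
    exact ⟨i, (Quotient.sound hi).symm⟩

end Urset

/-! ### Comparing sets with words of codes -/

section Comparison

variable [Preorder P]

/-- The set `x` over `P^{<ω}` lies below the word `w`. -/
inductive SetLe : Urset (List P) → List (Code P) → Prop
  | ur (s : List P) : SetLe (.ur s) (urWord s)
  -- The unfoldings are given by a function `g` instead of existentials, so that induction supplies
  -- a hypothesis for every element of `x`.
  | set {x : Urset (List P)} {w : List (Code P)} (hx : ¬ x.IsUr)
    (g : Urset (List P) → List (Code P)) (hg : ∀ x' ∈ x.elems, WordStep w (g x'))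
    (h : ∀ x' ∈ x.elems, SetLe x' (g x')) : SetLe x w
  -- Closure under both orders is built in; `SetLe.lesssim` shows that this is sound.
  | mono {x : Urset (List P)} {w v : List (Code P)} : Embeds w v → SetLe x w → SetLe x v
  | le {x y : Urset (List P)} {w : List (Code P)} : x.Lesssim (SeqEmbed P) y → SetLe y w →
    SetLe x w

/-- The word `w` lies below the set `x` over `P^{<ω}`. -/
inductive WordLe : List (Code P) → Urset (List P) → Prop
  | ur (s : List P) : WordLe (urWord s) (.ur s)
  | set {x : Urset (List P)} {w : List (Code P)} (hx : ¬ x.IsUr)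
    (g : List (Code P) → Urset (List P)) (hg : ∀ w', WordStep w w' → g w' ∈ x.elems)
    (h : ∀ w', WordStep w w' → WordLe w' (g w')) : WordLe w x
  | mono {x : Urset (List P)} {w v : List (Code P)} : Embeds w v → WordLe v x → WordLe w x

theorem SetLe.of_forall {x : Urset (List P)} {w : List (Code P)} (hx : ¬ x.IsUr)
    (h : ∀ x' ∈ x.elems, ∃ w', WordStep w w' ∧ SetLe x' w') : SetLe x w := by
  choose! g hg hg' using h
  exact .set hx g hg hg'

theorem WordLe.of_forall {x : Urset (List P)} {w : List (Code P)} (hx : ¬ x.IsUr)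
    (h : ∀ w', WordStep w w' → ∃ x' ∈ x.elems, WordLe w' x') : WordLe w x := by
  have : Nonempty (Urset (List P)) := ⟨x⟩
  choose! g hg hg' using h
  exact .set hx g hg hg'

theorem WordLe.pump {u v : List (Code P)} {x : Urset (List P)} (hu : WordLe u x) (h : Pump u v) :
    WordLe v x := by
  induction hu generalizing v with
  | ur s =>
    rw [h.eq_urWord]
    exact .ur s
  | set hx g hg hg' _ =>
    exact .set hx g (fun w' hw' => hg w' (h.wordStep hw')) fun w' hw' => hg' w' (h.wordStep hw')
  | mono hle _ ih =>
    obtain ⟨w', hw', h'⟩ := Pump.simulate hle h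
    exact .mono h' (ih hw')

instance : IsTrans (List P) (SeqEmbed P) :=
  inferInstanceAs (IsTrans (List P) (List.SublistForall₂ (· ≤ ·)))

/-- An element of `x` gives an unfolding of `w`, which is carried along the embedding to one of `v`,
which in turn gives an element of `y`. When one side is an urelement its word unfolds only to
itself, so that side stays put while the other moves. -/
theorem SetLe.lesssim {x : Urset (List P)} {w : List (Code P)} (hx : SetLe x w)
    {v : List (Code P)} (hwv : Embeds w v) {y : Urset (List P)} (hy : WordLe v y) :
    x.Lesssim (SeqEmbed P) y := by
  induction hx generalizing v y with
  | ur s =>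
    induction hy with
    | ur t => exact (Urset.lesssim_ur_ur _ _ _).2 (embeds_urWord.1 hwv)
    | set hy g hg hg' ih =>
      have hs : WordStep (urWord s) (urWord s) := by
        obtain ⟨w, hw⟩ := WordStep.exists (urWord s)
        rwa [hw.eq_urWord] at hw
      obtain ⟨v', hv', h⟩ := hs.simulate hwv
      exact (Urset.ur_lesssim_iff hy).2 ⟨_, hg v' hv', ih v' hv' h⟩
    | mono hle _ ih => exact ih (_root_.trans hwv hle)
  | set hx g hg hg' ih =>
    induction hy with
    | ur t =>
      refine (Urset.lesssim_ur_iff hx).2 fun x' hx' => ?_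
      obtain ⟨v', hv', h⟩ := (hg x' hx').simulate hwv
      rw [hv'.eq_urWord] at h
      exact ih x' hx' h (.ur t)
    | set hy g' hg'' hg''' _ =>
      refine (Urset.lesssim_set_set _ hx hy).2 fun x' hx' => ?_
      obtain ⟨v', hv', h⟩ := (hg x' hx').simulate hwv
      exact ⟨_, hg'' v' hv', ih x' hx' h (hg''' v' hv')⟩
    | mono hle _ ih' => exact ih' (_root_.trans hwv hle)
  | mono hle _ ih => exact ih (_root_.trans hle hwv) hy
  | le hle _ ih => exact hle.trans (ih hwv hy)

end Comparison

open HigmanIdeal (Factor lang lang_append IsPrime)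

/-! ### Representing hereditarily directed sets by words of codes -/

/-- Hereditarily nonempty and upward-directed sets. -/
inductive HereditarilyDirected {Q : Type u} (r : Q → Q → Prop) : Urset Q → Prop
  | ur (q : Q) : HereditarilyDirected r (.ur q)
  | set {x : Urset Q} (hx : ¬ x.IsUr) (hne : x.elems.Nonempty)
    (hdir : DirectedOn (Urset.Lesssim r) x.elems)
    (h : ∀ x' ∈ x.elems, HereditarilyDirected r x') : HereditarilyDirected r x

theorem exists_range_eq {β : Type (u + 1)} (T : Set β) [Small.{u} T] (hT : T.Nonempty) :
    ∃ (ι : Type u) (_ : Nonempty ι) (f : ι → β), Set.range f = T := by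
  have : Nonempty T := hT.to_subtype
  refine ⟨Shrink.{u} T, (equivShrink T).symm.nonempty, fun i => ((equivShrink T).symm i).1, ?_⟩
  ext b
  constructor
  · rintro ⟨i, rfl⟩
    exact ((equivShrink T).symm i).2
  · exact fun hb => ⟨equivShrink T ⟨b, hb⟩, by simp⟩

theorem isUr_toSet_of_mem_urWord {s : List P} {c : Code P} (hc : c ∈ urWord s) : c.toSet.IsUr := by
  obtain ⟨p, -, rfl⟩ := List.mem_map.1 hc
  trivial

section

variable {γ : Ordinal.{u}} {S : Set (Code P)} [Small.{u} S]
  (hS : ∀ c ∈ S, c.toSet.IsUr ∨ c.toSet.rank < γ)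
include hS

/-- The words over a set of codes are the unfoldings of a single code. -/
theorem exists_star {T : Set (Code P)} (hTS : T ⊆ S) (hT : T.Nonempty) :
    ∃ (ι : Type u) (h : Nonempty ι) (f : ι → Code P), (Code.star ι h f).toSet.rank ≤ γ ∧
      ∀ u : List (Code P), CodeStep (.star ι h f) u ↔ ∀ c ∈ u, c ∈ T := by
  have := small_subset hTS
  obtain ⟨ι, hι, f, hf⟩ := exists_range_eq T hT
  refine ⟨ι, hι, f, PreUrset.rank_le_iff.2 ?_, fun u => ⟨?_, fun hu => ?_⟩⟩
  · rintro (_ | i) h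
    · exact (h trivial).elim
    · exact (hS _ (hTS (hf ▸ Set.mem_range_self i))).resolve_left h
  · rintro ⟨⟩ c hc
    obtain ⟨i, -, rfl⟩ := List.mem_map.1 hc
    exact hf ▸ Set.mem_range_self i
  · obtain ⟨l, rfl⟩ : ∃ l : List ι, l.map f = u := by
      have : ∀ c ∈ u, ∃ i, f i = c := fun c hc => by
        have := hu c hc
        rwa [← hf] at this
      clear hu
      induction u with
      | nil => exact ⟨[], rfl⟩
      | cons c u ih =>
        obtain ⟨l, rfl⟩ := ih fun c hc => this c (List.mem_cons_of_mem _ hc)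
        obtain ⟨i, rfl⟩ := this c (List.mem_cons_self ..)
        exact ⟨i :: l, rfl⟩
    exact .star ι hι f l

/-- The words of at most one letter are the unfoldings of a single letter. -/
theorem exists_letter {T : Set (Letter P)} (hTS : ∀ a ∈ T, Code.letter a ∈ S) (hT : T.Nonempty) :
    ∃ (ι : Type u) (h : Nonempty ι) (f : ι → Letter P),
      (Code.letter (.mk ι h f)).toSet.rank ≤ γ ∧ Set.range f = T := by
  have : Small.{u} T := small_of_injective (β := S) (f := fun a => ⟨_, hTS a.1 a.2⟩)
    fun a b h => Subtype.ext (Code.letter.inj (Subtype.ext_iff.1 h))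
  obtain ⟨ι, hι, f, hf⟩ := exists_range_eq T hT
  refine ⟨ι, hι, f, PreUrset.rank_le_iff.2 fun i h => ?_, hf⟩
  exact (hS _ (hTS _ (hf ▸ Set.mem_range_self i))).resolve_left h

end

/-! ### Folding products of ideals into words of codes -/

variable [Preorder P]

/-- The word `W` of codes of level at most `γ` unfolds to the words in `A`, up to domination and
repetition of codes `star`. -/
structure Represents (γ : Ordinal.{u}) (A : Set (List (Code P))) (W : List (Code P)) : Prop where
  rank_le : ∀ c ∈ W, c.toSet.rank ≤ γ
  exists_step : ∀ u ∈ A, ∃ w, WordStep W w ∧ Embeds u w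
  exists_mem : ∀ w, WordStep W w → ∃ u ∈ A, ∃ v, Pump u v ∧ Embeds w v

theorem embeds_refl (u : List (Code P)) : Embeds u u :=
  List.SublistForall₂.is_refl.refl u

theorem represents_nil (γ : Ordinal.{u}) : Represents γ {([] : List (Code P))} [] where
  rank_le := by simp
  exists_step := by
    rintro u rfl
    exact ⟨[], .nil, .nil⟩
  exists_mem := by
    rintro w ⟨⟩
    exact ⟨[], rfl, [], .nil, .nil⟩

theorem Represents.append {γ : Ordinal.{u}} {A B : Set (List (Code P))} {W V : List (Code P)}
    (h : Represents γ A W) (h' : Represents γ B V) :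
    Represents γ {u | ∃ a ∈ A, ∃ b ∈ B, u = a ++ b} (W ++ V) where
  rank_le c hc := (List.mem_append.1 hc).elim (h.rank_le c) (h'.rank_le c)
  exists_step := by
    rintro _ ⟨a, ha, b, hb, rfl⟩
    obtain ⟨w, hw, haw⟩ := h.exists_step a ha
    obtain ⟨v, hv, hbv⟩ := h'.exists_step b hb
    exact ⟨_, hw.append hv, haw.append hbv⟩
  exists_mem := by
    intro w hw
    obtain ⟨w₁, w₂, h₁, h₂, rfl⟩ := hw.exists_of_append
    obtain ⟨a, ha, v₁, hp₁, he₁⟩ := h.exists_mem w₁ h₁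
    obtain ⟨b, hb, v₂, hp₂, he₂⟩ := h'.exists_mem w₂ h₂
    exact ⟨_, ⟨a, ha, b, hb, rfl⟩, _, hp₁.append hp₂, he₁.append he₂⟩

section

variable {γ : Ordinal.{u}} {S : Set (Code P)} [Small.{u} S]
  (hS : ∀ c ∈ S, c.toSet.IsUr ∨ c.toSet.rank < γ)
include hS

theorem exists_represents_star {T : Set (Code P)} (hTS : T ⊆ S) :
    ∃ W, Represents γ {u | ∀ c ∈ u, c ∈ T} W := by
  rcases T.eq_empty_or_nonempty with rfl | hT
  · have : {u : List (Code P) | ∀ c ∈ u, c ∈ (∅ : Set (Code P))} = {[]} := by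
      ext u
      simp [List.eq_nil_iff_forall_not_mem]
    exact ⟨[], this ▸ represents_nil γ⟩
  · obtain ⟨ι, hι, f, hrank, hf⟩ := exists_star hS hTS hT
    refine ⟨[.star ι hι f], by simpa using hrank, fun u hu => ?_, fun w hw => ?_⟩
    · exact ⟨_, .cons ((hf u).2 hu) .nil, by simpa using embeds_refl u⟩
    · obtain _ | ⟨hc, ⟨⟩⟩ := hw
      exact ⟨_, by simpa using (hf _).1 hc, _, Pump.refl _, embeds_refl _⟩

/-- If the letters in `T` are cofinal, they are collected into one letter. Otherwise all codes of
`T` above some `c₀` are `star` codes, and the `star` code over `T` will do: by directedness every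
word over `T` embeds into a repetition of a single `star` code `d ∈ T`, which is a pumping of `[d]`.
-/
theorem exists_represents_opt {T : Set (Code P)} (hTS : T ⊆ S) (hT : DirectedOn (· ≤ ·) T) :
    ∃ W, Represents γ {u | u = [] ∨ ∃ c ∈ T, u = [c]} W := by
  rcases T.eq_empty_or_nonempty with rfl | hne
  · have : {u : List (Code P) | u = [] ∨ ∃ c ∈ (∅ : Set (Code P)), u = [c]} = {[]} := by
      ext u
      simp
    exact ⟨[], this ▸ represents_nil γ⟩
  by_cases hcof : ∀ c ∈ T, ∃ a, Code.letter a ∈ T ∧ c ≤ .letter a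
  · obtain ⟨ι, hι, f, hrank, hf⟩ := exists_letter hS (T := {a | Code.letter a ∈ T})
      (fun a ha => hTS ha) (let ⟨c, hc⟩ := hne; let ⟨a, ha, _⟩ := hcof c hc; ⟨a, ha⟩)
    have hfT : ∀ i, Code.letter (f i) ∈ T := fun i => by
      have : f i ∈ {a | Code.letter a ∈ T} := hf ▸ Set.mem_range_self i
      exact this
    refine ⟨[.letter (.mk ι hι f)], by simpa using hrank, ?_, fun w hw => ?_⟩
    · rintro u (rfl | ⟨c, hc, rfl⟩)
      · exact ⟨_, .cons (.nil ι hι f) .nil, .nil⟩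
      · obtain ⟨a, ha, hca⟩ := hcof c hc
        have : a ∈ Set.range f := hf ▸ ha
        obtain ⟨i, rfl⟩ := this
        exact ⟨_, .cons (.mk ι hι f i) .nil, .cons hca .nil⟩
    · obtain _ | ⟨hc, ⟨⟩⟩ := hw
      cases hc with
      | nil => exact ⟨[], .inl rfl, _, .nil, .nil⟩
      | mk _ _ _ i => exact ⟨_, .inr ⟨_, hfT i, rfl⟩, _, Pump.refl _, embeds_refl _⟩
  · push Not at hcof
    obtain ⟨c₀, hc₀, hcof⟩ := hcof
    have hstar : ∀ c ∈ T, c₀ ≤ c → ∃ ι h f, c = Code.star ι h f := by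
      rintro (a | ⟨ι, h, f⟩) hc hle
      · exact (hcof a hc hle).elim
      · exact ⟨ι, h, f, rfl⟩
    have hbound : ∀ l : List (Code P), (∀ c ∈ l, c ∈ T) →
        ∃ d ∈ T, c₀ ≤ d ∧ ∀ c ∈ l, c ≤ d := by
      intro l hl
      induction l with
      | nil => exact ⟨c₀, hc₀, le_rfl, by simp⟩
      | cons c l ih =>
        obtain ⟨d, hd, hcd, hld⟩ := ih fun c hc => hl c (List.mem_cons_of_mem _ hc)
        obtain ⟨e, he, hde, hce⟩ := hT d hd c (hl c (List.mem_cons_self ..))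
        refine ⟨e, he, hcd.trans hde, fun b hb => ?_⟩
        rcases List.mem_cons.1 hb with rfl | hb
        · exact hce
        · exact (hld b hb).trans hde
    obtain ⟨ι, hι, f, hrank, hf⟩ := exists_star hS hTS hne
    refine ⟨[.star ι hι f], by simpa using hrank, ?_, fun w hw => ?_⟩
    · rintro u (rfl | ⟨c, hc, rfl⟩)
      · exact ⟨_, .cons ((hf []).2 (by simp)) .nil, .nil⟩
      · exact ⟨_, .cons ((hf [c]).2 (by simpa using hc)) .nil, by simpa using embeds_refl [c]⟩
    · obtain _ | ⟨hc, ⟨⟩⟩ := hw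
      rename_i w
      obtain ⟨d, hd, hcd, hwd⟩ := hbound w ((hf w).1 hc)
      obtain ⟨κ, hκ, g, rfl⟩ := hstar d hd hcd
      refine ⟨_, .inr ⟨_, hd, rfl⟩, _, .star κ hκ g w.length .nil, ?_⟩
      simp only [List.append_nil]
      clear hc
      induction w with
      | nil => exact .nil
      | cons c w ih =>
        exact .cons (hwd c (List.mem_cons_self ..)) (ih fun c hc => hwd c (List.mem_cons_of_mem _ hc))

/-- Products of ideals of codes are unfoldings of words of codes. -/
theorem exists_represents_lang (w : List (Factor S)) (hw : ∀ F ∈ w, F.IsIdeal) :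
    ∃ W, Represents γ {u | ∃ v ∈ lang w, u = v.map Subtype.val} W := by
  induction w with
  | nil =>
    have : {u : List (Code P) | ∃ v ∈ lang ([] : List (Factor S)), u = v.map Subtype.val} = {[]} := by
      ext u
      simp [lang]
    exact ⟨[], this ▸ represents_nil γ⟩
  | cons F w ih =>
    obtain ⟨W, hW⟩ := ih fun G hG => hw G (List.mem_cons_of_mem _ hG)
    suffices H : ∃ V, Represents γ {u | ∃ v ∈ lang [F], u = v.map Subtype.val} V by
      obtain ⟨V, hV⟩ := H
      refine ⟨V ++ W, ?_⟩
      convert hV.append hW using 1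
      rw [← List.singleton_append, lang_append]
      ext u
      constructor
      · rintro ⟨_, ⟨a, ha, b, hb, rfl⟩, rfl⟩
        exact ⟨_, ⟨a, ha, rfl⟩, _, ⟨b, hb, rfl⟩, List.map_append⟩
      · rintro ⟨_, ⟨a, ha, rfl⟩, _, ⟨b, hb, rfl⟩, rfl⟩
        exact ⟨_, ⟨a, ha, b, hb, rfl⟩, List.map_append.symm⟩
    have hF := hw F (List.mem_cons_self ..)
    cases F with
    | star D =>
      obtain ⟨V, hV⟩ := exists_represents_star hS (T := Subtype.val '' D)
        (Set.image_subset_iff.2 fun a _ => a.2)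
      refine ⟨V, ?_⟩
      convert hV using 1
      ext u
      constructor
      · rintro ⟨_, ⟨l, hl, _, rfl, rfl⟩, rfl⟩ c hc
        obtain ⟨a, ha, rfl⟩ := List.mem_map.1 hc
        exact ⟨a, hl a (by simpa using ha), rfl⟩
      · intro hu
        have : ∀ c ∈ u, c ∈ S := fun c hc => let ⟨a, _, ha⟩ := hu c hc; ha ▸ a.2
        lift u to List S using this
        refine ⟨u, ⟨u, fun a ha => ?_, [], rfl, by simp⟩, rfl⟩
        obtain ⟨b, hb, hba⟩ := hu a.1 (List.mem_map_of_mem ha)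
        rwa [← Subtype.ext hba]
    | opt D =>
      obtain ⟨V, hV⟩ := exists_represents_opt hS (T := Subtype.val '' D)
        (Set.image_subset_iff.2 fun a _ => a.2) (by
          rintro _ ⟨a, ha, rfl⟩ _ ⟨b, hb, rfl⟩
          obtain ⟨c, hc, hac, hbc⟩ := hF.2 a ha b hb
          exact ⟨c, ⟨c, hc, rfl⟩, hac, hbc⟩)
      refine ⟨V, ?_⟩
      convert hV using 1
      ext u
      constructor
      · rintro ⟨_, rfl | ⟨a, ha, _, rfl, rfl⟩, rfl⟩
        · exact .inl rfl
        · exact .inr ⟨a, ⟨a, ha, rfl⟩, rfl⟩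
      · rintro (rfl | ⟨_, ⟨a, ha, rfl⟩, rfl⟩)
        · exact ⟨[], .inl rfl, rfl⟩
        · exact ⟨[a], .inr ⟨a, ha, [], rfl, rfl⟩, rfl⟩

end

/-- If the codes of level below `α` are well-quasi-ordered, then every hereditarily directed set of
rank below `α` is equivalent to a word of such codes. -/
theorem HereditarilyDirected.exists_word {α : Ordinal.{u}}
    (hα : {c : Code P | c.toSet.IsUr ∨ c.toSet.rank < α}.PartiallyWellOrderedOn (· ≤ ·))
    {x : Urset (List P)} (hx : HereditarilyDirected (SeqEmbed P) x) (hxα : x.IsUr ∨ x.rank < α) :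
    ∃ w, SetLe x w ∧ WordLe w x ∧
      ∀ c ∈ w, c.toSet.IsUr ∨ ¬ x.IsUr ∧ c.toSet.rank ≤ x.rank := by
  induction hx with
  | ur s => exact ⟨urWord s, .ur s, .ur s, fun c hc => .inl (isUr_toSet_of_mem_urWord hc)⟩
  | @set x hx hne hdir _ ih =>
    replace hxα := hxα.resolve_left hx
    have hrank : ∀ x' ∈ x.elems, ¬ x'.IsUr → x'.rank < x.rank :=
      (Urset.rank_le_iff hx).1 le_rfl
    have hw : ∀ x' : x.elems, ∃ w, SetLe x'.1 w ∧ WordLe w x'.1 ∧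
        ∀ c ∈ w, c.toSet.IsUr ∨ ¬ x'.1.IsUr ∧ c.toSet.rank ≤ x'.1.rank := fun x' =>
      ih x'.1 x'.2 (or_iff_not_imp_left.2 fun h => (hrank _ x'.2 h).trans hxα)
    choose w hxw hwx hwr using hw
    let S : Set (Code P) := ⋃ x' : x.elems, {c | c ∈ w x'}
    have hsmall : Small.{u} S := by
      have := Urset.small_elems x
      have : ∀ x' : x.elems, Small.{u} {c | c ∈ w x'} := fun x' =>
        have := (List.finite_toSet (w x')).countable.to_subtype
        Countable.toSmall _
      exact small_iUnion _
    have hS : ∀ c ∈ S, c.toSet.IsUr ∨ c.toSet.rank < x.rank := by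
      intro c hc
      obtain ⟨x', hc⟩ := Set.mem_iUnion.1 hc
      exact (hwr x' c hc).imp_right fun h => h.2.trans_lt (hrank _ x'.2 h.1)
    have hwqo : WellQuasiOrderedLE S := by
      refine ⟨fun f => ?_⟩
      exact hα.exists_lt fun n => (hS _ (f n).2).imp_right fun h => h.trans hxα
    -- Large means cofinal for `x`. This is prime by directedness: if `A` fails at `a` and `B` at
    -- `b`, then `A ∪ B` fails at a common upper bound.
    let C : Set (List S) → Prop := fun A => ∀ x' ∈ x.elems, ∃ u ∈ A, SetLe x' (u.map Subtype.val)
    have hC : IsPrime C := by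
      refine ⟨fun A B hAB hA x' hx' => ?_, fun A B hAB => ?_, fun h => ?_⟩
      · obtain ⟨u, hu, h⟩ := hA x' hx'
        exact ⟨u, hAB hu, h⟩
      · by_contra! hcon
        simp only [C, not_forall] at hcon
        obtain ⟨⟨a, ha, hA⟩, ⟨b, hb, hB⟩⟩ := hcon
        obtain ⟨c, hc, hac, hbc⟩ := hdir a ha b hb
        obtain ⟨u, hu | hu, hcu⟩ := hAB c hc
        · exact hA ⟨u, hu, .le hac hcu⟩
        · exact hB ⟨u, hu, .le hbc hcu⟩
      · obtain ⟨x', hx'⟩ := hne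
        obtain ⟨u, hu, -⟩ := h x' hx'
        exact hu
    -- A large product inside `L` bounds `x` from both sides: largeness gives `SetLe`, inclusion in
    -- `L` gives `WordLe`.
    let L : Set (List S) := {u | ∃ x' ∈ x.elems, WordLe (u.map Subtype.val) x'}
    have hL : ∀ u v, Embeds v u → u ∈ L → v ∈ L := by
      rintro u v h ⟨x', hx', hu⟩
      refine ⟨x', hx', .mono ?_ hu⟩
      rw [Embeds, List.sublistForall₂_map_left_iff, List.sublistForall₂_map_right_iff]
      exact h
    have hCL : C L := by
      intro x' hx'
      have hmem : ∀ c ∈ w ⟨x', hx'⟩, c ∈ S := fun c hc => Set.mem_iUnion.2 ⟨_, hc⟩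
      obtain ⟨u, hu⟩ : ∃ u : List S, u.map Subtype.val = w ⟨x', hx'⟩ :=
        CanLift.prf _ hmem
      exact ⟨u, ⟨x', hx', hu ▸ hwx _⟩, hu ▸ hxw ⟨x', hx'⟩⟩
    obtain ⟨v₀, hv₀, hv₀L, hCv₀⟩ := HigmanIdeal.exists_lang_subset hC hL hCL
    obtain ⟨v, hv, hvL, hCv⟩ := HigmanIdeal.exists_isIdeal_lang_subset hC v₀ [] hv₀ hCv₀
    obtain ⟨W, hW⟩ := exists_represents_lang hS v hv
    refine ⟨W, .of_forall hx fun x' hx' => ?_, .of_forall hx fun w' hw' => ?_, fun c hc =>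
      .inr ⟨hx, hW.rank_le c hc⟩⟩
    · obtain ⟨u, hu, hxu⟩ := hCv x' hx'
      obtain ⟨w', hw', h⟩ := hW.exists_step _ ⟨u, hu, rfl⟩
      exact ⟨w', hw', .mono h hxu⟩
    · obtain ⟨_, ⟨u, hu, rfl⟩, v', hp, he⟩ := hW.exists_mem w' hw'
      obtain ⟨x', hx', h⟩ := hv₀L (hvL hu)
      exact ⟨x', hx', .mono he (h.pump hp)⟩

/-- The hereditarily directed sets of rank below `α` over `P^{<ω}` are well-quasi-ordered. -/
theorem partiallyWellOrderedOn_hereditarilyDirected {ζ α : Ordinal.{u}}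
    (hP : BQO.IsAlphaWqo P ζ) (hα : α < ζ) :
    {x : Urset (List P) | HereditarilyDirected (SeqEmbed P) x ∧
      (x.IsUr ∨ x.rank < α)}.PartiallyWellOrderedOn (Urset.Lesssim (SeqEmbed P)) := by
  have hcode : {c : Code P | c.toSet.IsUr ∨ c.toSet.rank < α}.PartiallyWellOrderedOn (· ≤ ·) := by
    -- The arrays that arise have rank at most `α`, hence below `ζ`.
    have h := PreUrset.partiallyWellOrderedOn_rank_lt (Q := P ⊕ PUnit.{u + 1}) (α := α)
      fun F hF f => BQO.not_isBadArray_sum hP F (hF.trans_lt hα) f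
    rw [Set.partiallyWellOrderedOn_iff_exists_lt] at h ⊢
    exact fun f hf => h (fun n => (f n).toSet) hf
  have hword := Set.PartiallyWellOrderedOn.partiallyWellOrderedOn_sublistForall₂ _ hcode
  rw [Set.partiallyWellOrderedOn_iff_exists_lt] at hword ⊢
  intro x hx
  choose w hxw hwx hwr using fun n => (hx n).1.exists_word hcode (hx n).2
  obtain ⟨m, n, hmn, h⟩ := hword w fun n c hc => (hwr n c hc).imp_right fun h =>
    h.2.trans_lt ((hx n).2.resolve_left h.1)
  exact ⟨m, n, hmn, (hxw m).lesssim h (hwx n)⟩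

/-! ### Both hierarchies consist of hereditarily directed sets of bounded rank -/

theorem Urset.hereditarilyDirected_of_mem_approxIdeals {Q : Type u} {r : Q → Q → Prop}
    {α : Ordinal.{u}} {x : Urset Q} (hx : x ∈ approxIdeals r α) :
    HereditarilyDirected r x ∧ (x.IsUr ∨ x.rank < α) := by
  induction α using WellFoundedLT.induction generalizing x with | _ α ih => ?_
  rw [approxIdeals] at hx
  rcases hx with hx | hx
  · obtain ⟨q, rfl⟩ := isUr_iff.1 hx
    exact ⟨.ur q, .inl hx⟩
  · obtain ⟨⟨β, hβ⟩, hur, hne, ⟨A, -, -, hA⟩, hdir⟩ := Set.mem_iUnion.1 hx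
    have hmem : ∀ x' ∈ elems x, x' ∈ approxIdeals r β := fun x' hx' => (hA ▸ hx').1
    refine ⟨.set hur hne hdir fun x' hx' => (ih β hβ (hmem x' hx')).1, .inr ?_⟩
    exact ((rank_le_iff hur).2 fun y hy hyu => (ih β hβ (hmem y hy)).2.resolve_left hyu).trans_lt hβ

theorem Urset.hereditarilyDirected_of_mem_iteratedIdeals {Q : Type u} {r : Q → Q → Prop}
    {α : Ordinal.{u}} {x : Urset Q} (hx : x ∈ iteratedIdeals r α) :
    HereditarilyDirected r x ∧ (x.IsUr ∨ x.rank < α) := by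
  induction α using WellFoundedLT.induction generalizing x with | _ α ih => ?_
  rw [iteratedIdeals] at hx
  by_cases hur : x.IsUr
  · obtain ⟨q, rfl⟩ := isUr_iff.1 hur
    exact ⟨.ur q, .inl hur⟩
  · obtain ⟨⟨hdot, hrank⟩, hmem, hdir⟩ := hx.resolve_left hur
    refine ⟨.set hur ?_ hdir fun x' hx' => ?_, hrank⟩
    -- A set with an urelement in its transitive closure has an element; this excludes the empty
    -- set.
    · obtain ⟨y, -, hy⟩ := hdot.resolve_left hur
      obtain ⟨z, -, hz⟩ := Relation.TransGen.tail'_iff.1 hy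
      exact ⟨z, hz⟩
    · obtain ⟨β, hβ⟩ := hmem x' hx'
      exact (ih β.1 β.2 hβ).1

theorem mainTheorem3 (P : Type u) [Preorder P] :
    (∀ ζ : Ordinal.{u}, BQO.IsAlphaWqo P ζ →
      ∀ α : Ordinal.{u}, α < ζ →
        (Urset.approxIdeals (SeqEmbed P) α).PartiallyWellOrderedOn
          (Urset.Lesssim (SeqEmbed P))) ∧
    (BQO.IsBqo P →
      ∀ α : Ordinal.{u},
        (Urset.approxIdeals (SeqEmbed P) α).PartiallyWellOrderedOn
          (Urset.Lesssim (SeqEmbed P)) ∧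
        (Urset.iteratedIdeals (SeqEmbed P) α).PartiallyWellOrderedOn
          (Urset.Lesssim (SeqEmbed P))) := by
  refine ⟨fun ζ hP α hα => ?_, fun hP α => ⟨?_, ?_⟩⟩
  · exact (partiallyWellOrderedOn_hereditarilyDirected hP hα).mono
      fun x => Urset.hereditarilyDirected_of_mem_approxIdeals
  · exact (partiallyWellOrderedOn_hereditarilyDirected (hP _) (Order.lt_succ α)).mono
      fun x => Urset.hereditarilyDirected_of_mem_approxIdeals
  · exact (partiallyWellOrderedOn_hereditarilyDirected (hP _) (Order.lt_succ α)).mono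
      fun x => Urset.hereditarilyDirected_of_mem_iteratedIdeals
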